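/- Consider the Alman–Song approximate attention algorithm with input matrices $Q,K,V\in\mathbb R^{n\times d}$, in which the exponential function is replaced by a polynomial of degree $g\ge 1$. It computes $D^{-1}\bigl(U_1(U_2^{\top}V)\bigr)$ with $D=\mathrm{diag}(U_1(U_2^{\top}\mathbf 1))$, where $U_1,U_2\in\mathbb R^{n\times r}$, $r=\binom{d+g}{g}$, have one column for each monomial of degree at most $g$ in $d$ variables, and the entry of $U_1$ (of $U_2$) in row $i$ and column $m$ is a scalar multiple of the monomial $m$ evaluated at row $i$ of $Q$ (of $K$). All matrix products are computed by forming the products of pairs of entries and summing them. In the computational DAG of the algorithm, the entries of $Q,K,V$, of $U_1,U_2$, the scalar products, the sums (the entries of $H=U_2^{\top}V$, $U_2^{\top}\mathbf 1$, $U_1H$ and $D$) and the entries of the output are the nodes; the parents of an entry of $U_1$ or $U_2$ are those entries of $Q$ or $K$ that occur in its monomial, and the parents of any other node are the operands of its operation. The I/O cost of this DAG with fast memory of capacity $M$ is measured in the red-blue pebble game with partial computations. A red (blue) pebble on a node means that its current, possibly partially aggregated, value is in fast (slow) memory, and there are never more than $M$ red pebbles. A step may load a value to fast memory or save it to slow memory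 (cost $1$ each), may aggregate a fully computed operand in fast memory into a value that is in fast memory or is just being started, which invalidates a copy of this value in slow memory (cost $0$), or may delete a value (cost $0$); deleted values may be recomputed. Initially the source nodes have blue pebbles, and at the end all sinks must have blue pebbles and be fully computed. The optimal I/O cost $\mathrm{OPT}$ is the minimal total cost of such a sequence of steps. Assume that $n\ge r$, $M=o(d\cdot r)$ and $g=o(\log M)$. Then \[ \mathrm{OPT}=O\!\left(\frac{n\cdot r\cdot d\cdot(4e^2)^g}{M^{\frac{g}{g+1}}}\right)\qquad\text{and}\qquad \mathrm{OPT}=\Omega\!\left(\frac{n\cdot r\cdot d\cdot g}{M^{\frac{g}{g+1}}}\right), \] with absolute constants. That is, there are absolute constants $C,c>0$ such that for every family of parameters $(n,d,g,M)$ with $g\ge 1$ and $n\ge r$ along which $M=o(d\cdot r)$ and $g=o(\log M)$, eventually $c\cdot n r d g/M^{g/(g+1)}\le \mathrm{OPT}\le C\cdot n r d(4e^2)^g/M^{g/(g+1)}$. -/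

import Mathlib

open Filter Asymptotics

/-! ## Computational DAGs and the red-blue pebble game with partial computations -/

/-- A computational DAG on the node set `V`: `pred v` is the set of parents of `v`, that is, the
operands of the operation `v`. -/
structure CompDAG (V : Type) where
  pred : V → Finset V
  acyclic : WellFounded fun u v => u ∈ pred v

namespace CompDAG

variable {V : Type}

/-- A source (an input of the computation): a node without parents. -/
def IsSource (G : CompDAG V) (v : V) : Prop := G.pred v = ∅

/-- A sink (an output of the computation): a node without children. -/
def IsSink (G : CompDAG V) (v : V) : Prop := ∀ w, v ∉ G.pred w

end CompDAG

/-- A configuration of the pebble game. A red (blue) pebble on `v` says that the current, possibly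
partial, value of `v` is in fast (slow) memory; `agg v` is the set of those parents of `v` that
have already been aggregated into this value (the marked incoming edges of `v`). -/
structure PebbleConfig (V : Type) where
  red : Finset V
  blue : Set V
  agg : V → Finset V

namespace CompDAG

variable {V : Type}

/-- The value of `v` is fully computed. -/
def Complete (G : CompDAG V) (c : PebbleConfig V) (v : V) : Prop := c.agg v = G.pred v

/-- The initial configuration: the fast memory is empty and the slow memory holds the inputs. -/
def initial (G : CompDAG V) : PebbleConfig V where
  red := ∅
  blue := {v | G.IsSource v}
  agg := fun _ => ∅

/-- The game is over when the fully computed outputs are all in slow memory. -/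
def IsFinal (G : CompDAG V) (c : PebbleConfig V) : Prop :=
  ∀ v, G.IsSink v → v ∈ c.blue ∧ G.Complete c v

variable [DecidableEq V]

/-- `G.Step c c' k`: one step of the game leads from `c` to `c'` and has I/O cost `k`. -/
inductive Step (G : CompDAG V) : PebbleConfig V → PebbleConfig V → ℕ → Prop
  /-- Load the value of `v` from slow memory. -/
  | load (c : PebbleConfig V) (v : V) (hv : v ∈ c.blue) :
      Step G c { c with red := insert v c.red } 1
  /-- Save the value of `v` to slow memory. -/
  | save (c : PebbleConfig V) (v : V) (hv : v ∈ c.red) :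
      Step G c { c with blue := insert v c.blue } 1
  /-- Aggregate the fully computed operand `u`, held in fast memory, into the value of `v`. This
  value must be in fast memory, or not have been started (no pebble on `v`). Afterwards the new
  value is only in fast memory, since a copy in slow memory is outdated. -/
  | compute (c : PebbleConfig V) (u v : V) (huv : u ∈ G.pred v) (hu : u ∈ c.red)
      (hcomplete : G.Complete c u) (hv : v ∈ c.red ∨ v ∉ c.blue) (hnew : u ∉ c.agg v) :
      Step G c
        { red := insert v c.red
          blue := c.blue \ {v}
          agg := Function.update c.agg v (insert u (c.agg v)) } 0
  /-- Remove the value of `v` from fast memory, keeping the copy in slow memory. -/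
  | evict (c : PebbleConfig V) (v : V) (hv : v ∈ c.blue) :
      Step G c { c with red := c.red.erase v } 0
  /-- Delete the value of `v` altogether; it may be recomputed from scratch later. -/
  | discard (c : PebbleConfig V) (v : V) :
      Step G c
        { red := c.red.erase v
          blue := c.blue \ {v}
          agg := Function.update c.agg v ∅ } 0

/-- `G.Reaches M c c' k`: a sequence of steps leads from `c` to `c'` with total I/O cost `k`, such
that there are never more than `M` red pebbles after any of its steps. -/
inductive Reaches (G : CompDAG V) (M : ℕ) : PebbleConfig V → PebbleConfig V → ℕ → Prop
  | refl (c : PebbleConfig V) : Reaches G M c c 0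
  | tail {c c' c'' : PebbleConfig V} {k s : ℕ} (h : Reaches G M c c' k) (hs : G.Step c' c'' s)
      (hM : c''.red.card ≤ M) : Reaches G M c c'' (k + s)

/-- The I/O costs of all pebblings of `G` with fast memory of capacity `M`. The optimal I/O cost
is the least element of this set. -/
def ioCosts (G : CompDAG V) (M : ℕ) : Set ℕ :=
  {k | ∃ c, G.IsFinal c ∧ G.Reaches M G.initial c k}

end CompDAG

/-! ## The approximate attention algorithm of Alman and Song -/

/-- The monomials of degree at most `g` in `d` variables, as exponent vectors. There are
`(d + g).choose g` of them. -/
abbrev AttMonomial (d g : ℕ) : Type :=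
  {m : Fin d → Fin (g + 1) // ∑ a, (m a : ℕ) ≤ g}

/-- The operations of the algorithm `D⁻¹ (U₁ (U₂ᵀ V))`, `D = diag (U₁ (U₂ᵀ 1))`, with input
matrices `Q`, `K`, `V` of size `n × d`, and with a polynomial of degree `g` in place of the
exponential function. -/
inductive AttNode (n d g : ℕ) : Type
  /-- entries of the inputs `Q`, `K`, `V` -/
  | Q (i : Fin n) (a : Fin d)
  | K (l : Fin n) (a : Fin d)
  | V (l : Fin n) (j : Fin d)
  /-- an entry of `U₁`: a scalar times the monomial `m` in the entries of row `i` of `Q`;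
  only the entries that occur in `m` are operands, so a constant entry is a source -/
  | U₁ (i : Fin n) (m : AttMonomial d g)
  /-- an entry of `U₂`: the monomial `m` in the entries of row `l` of `K` -/
  | U₂ (l : Fin n) (m : AttMonomial d g)
  /-- the product of the entries `(l, m)` of `U₂` and `(l, j)` of `V` -/
  | prodH (m : AttMonomial d g) (l : Fin n) (j : Fin d)
  /-- the entry `(m, j)` of `H = U₂ᵀ V` -/
  | H (m : AttMonomial d g) (j : Fin d)
  /-- the product of the entries `(i, m)` of `U₁` and `(m, j)` of `H` -/
  | prodA (i : Fin n) (m : AttMonomial d g) (j : Fin d)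
  /-- the entry `(i, j)` of `U₁ H` -/
  | A (i : Fin n) (j : Fin d)
  /-- the entry `m` of `U₂ᵀ 1` -/
  | S (m : AttMonomial d g)
  /-- the product of the entries `(i, m)` of `U₁` and `m` of `U₂ᵀ 1` -/
  | prodD (i : Fin n) (m : AttMonomial d g)
  /-- the entry `i` of the diagonal of `D`, that is, of `U₁ (U₂ᵀ 1)` -/
  | D (i : Fin n)
  /-- the entry `(i, j)` of the output `D⁻¹ U₁ H` -/
  | out (i : Fin n) (j : Fin d)
  deriving DecidableEq

namespace AttNode

variable {n d g : ℕ}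

/-- The operands of each operation. -/
def operands : AttNode n d g → Finset (AttNode n d g)
  | Q _ _ => ∅
  | K _ _ => ∅
  | V _ _ => ∅
  | U₁ i m => (Finset.univ.filter fun a => m.1 a ≠ 0).image fun a => Q i a
  | U₂ l m => (Finset.univ.filter fun a => m.1 a ≠ 0).image fun a => K l a
  | prodH m l j => {U₂ l m, V l j}
  | H m j => Finset.univ.image fun l => prodH m l j
  | prodA i m j => {U₁ i m, H m j}
  | A i j => Finset.univ.image fun m => prodA i m j
  | S m => Finset.univ.image fun l => U₂ l m
  | prodD i m => {U₁ i m, S m}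
  | D i => Finset.univ.image fun m => prodD i m
  | out i j => {A i j, D i}

/-- The layer of an operation, which witnesses acyclicity. -/
def layer : AttNode n d g → ℕ
  | Q _ _ | K _ _ | V _ _ => 0
  | U₁ _ _ | U₂ _ _ => 1
  | prodH _ _ _ => 2
  | H _ _ | S _ => 3
  | prodA _ _ _ | prodD _ _ => 4
  | A _ _ | D _ => 5
  | out _ _ => 6

theorem layer_lt_of_mem_operands {u v : AttNode n d g} (h : u ∈ operands v) :
    layer u < layer v := by
  cases v <;> simp only [operands, Finset.mem_image, Finset.mem_insert, Finset.mem_singleton,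
    Finset.notMem_empty] at h
  all_goals first
    | (rcases h with rfl | rfl <;> simp [layer])
    | (obtain ⟨_, _, rfl⟩ := h; simp [layer])

end AttNode

/-- The computational DAG of the approximate attention algorithm. -/
def attentionDAG (n d g : ℕ) : CompDAG (AttNode n d g) where
  pred := AttNode.operands
  acyclic := Subrelation.wf (fun h => AttNode.layer_lt_of_mem_operands h)
    (measure AttNode.layer).wf

/-! ## Counting monomials -/

/-! Put `x = M^(1/(g+1))`, so that `M = x · x^g` and the denominator in both bounds is `x^g`. The
asymptotic hypotheses enter only through `x ≥ 1000` and `1728 M ≤ d r`; everything else is explicit.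

Lower bound. A pebbling is cut into phases of I/O cost at most `M`. In a phase, at most `3M` values
are resident: red at the start, red at the end, or transferred in between. Every other available
value is built within the phase from operands that are themselves available in it
(`exists_isResident`). Each triple `(i, m, j)` has a time at which its product is available while `A
i j` or the output `(i, j)` is resident in the phase (`exists_useful_time`). `card_useful_le` bounds
these triples per phase. Only `O(M)` entries of `H` can be available, because each needs an operand
from every one of the `n ≥ r` rows of `V`. Hence rows `i` with at least `s` resident values, of
which there are `O(M/s)`, contribute `O(M²/s)` in all. A row with `ρ < s` resident values sees at
most `ρ` columns, and its monomials are resident or supported on at most `ρ` resident variables,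
which gives at most `ρ (ρ + (ρ+g).choose g)`. With `s` of order `g x`, both contributions are
`O(M²/s)`, so there are at least of order `n r d s / M²` phases of cost about `M`.

Upper bound. The variables are cut into blocks of size `b ≈ x/6`, and monomials are classed by their
degree in each block. A class involves at most `g b` variables and at most `(gb+g).choose g ≤ x^g/2`
monomials, so its entries of `H` in `b` columns fit in fast memory. For each class and each block of
columns the `n` rows are streamed at cost `O(g b)` each, and the entries of `U₁` and `U₂` are
recomputed on the fly without I/O (`attention_cost_upper`). There are at most `r (14.26/x)^g`
classes and `O(d/b)` column blocks; the remaining factor `g ≤ 2^g` gives `28.52^g ≤ (4e²)^g`. -/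

theorem Finset.card_piAntidiag_nat {ι : Type*} [DecidableEq ι] (s : Finset ι) (k : ℕ) :
    (s.piAntidiag k).card = (s.card + k - 1).choose k := by
  rw [← Finset.card_finsuppAntidiag_nat_eq_choose]
  symm
  refine Finset.card_bij (fun (f : ι →₀ ℕ) _ => (f : ι → ℕ)) ?_ ?_ ?_
  · intro f hf
    simp only [Finset.mem_finsuppAntidiag] at hf
    simp only [Finset.mem_piAntidiag]
    exact ⟨hf.1, fun i hi => hf.2 (Finsupp.mem_support_iff.2 hi)⟩
  · intro f _ f' _ h
    exact DFunLike.coe_injective h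
  · intro f hf
    simp only [Finset.mem_piAntidiag] at hf
    refine ⟨Finsupp.onFinset s f hf.2, ?_, rfl⟩
    simp only [Finset.mem_finsuppAntidiag]
    exact ⟨hf.1, Finsupp.support_onFinset_subset⟩

namespace AttMonomial

variable {d g : ℕ}

/-- The variables that occur in a monomial. -/
def supp (m : AttMonomial d g) : Finset (Fin d) := Finset.univ.filter fun a => m.1 a ≠ 0

theorem mem_supp {m : AttMonomial d g} {a : Fin d} : a ∈ m.supp ↔ m.1 a ≠ 0 := by simp [supp]

/-- The constant monomial. -/
def one : AttMonomial d g := ⟨fun _ => 0, by simp⟩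

theorem supp_eq_empty {m : AttMonomial d g} : m.supp = ∅ ↔ m = one := by
  constructor
  · intro h
    apply Subtype.ext
    funext a
    by_contra ha
    have : a ∈ m.supp := mem_supp.2 ha
    simp [h] at this
  · rintro rfl
    simp [supp, one]

/-- The number of monomials of degree at most `g` in the variables of `W`. -/
theorem card_supp_subset (W : Finset (Fin d)) :
    (Finset.univ.filter fun m : AttMonomial d g => m.supp ⊆ W).card
      = (W.card + g).choose g := by
  -- Stars and bars: the extra index `none` is a slack variable that carries the missing degree,
  -- which turns degree at most `g` into degree exactly `g`.
  have key := Finset.card_piAntidiag_nat (Finset.insertNone W) g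
  rw [Finset.card_insertNone, show W.card + 1 + g - 1 = W.card + g by omega] at key
  rw [← key]
  refine Finset.card_bij
    (fun m _ o => Option.elim o (g - ∑ a, (m.1 a : ℕ)) fun a => (m.1 a : ℕ)) ?_ ?_ ?_
  · intro m hm
    rw [Finset.mem_filter] at hm
    rw [Finset.mem_piAntidiag]
    constructor
    · rw [Finset.sum_insertNone]
      simp only [Option.elim]
      have : ∑ a ∈ W, (m.1 a : ℕ) = ∑ a, (m.1 a : ℕ) := by
        apply Finset.sum_subset (Finset.subset_univ _)
        intro a _ ha
        by_contra h
        exact ha (hm.2 (mem_supp.2 fun h0 => h (by simp [h0])))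
      rw [this]
      exact Nat.sub_add_cancel m.2
    · rintro (_ | a) h
      · simp
      · simp only [Option.elim] at h
        simp only [Finset.some_mem_insertNone]
        exact hm.2 (mem_supp.2 fun h0 => h (by simp [h0]))
  · intro m _ m' _ h
    apply Subtype.ext
    funext a
    have := congrFun h (some a)
    exact Fin.ext this
  · intro f hf
    rw [Finset.mem_piAntidiag, Finset.sum_insertNone] at hf
    have hle : ∀ a, f (some a) ≤ g := by
      intro a
      by_cases ha : a ∈ W
      · have := Finset.single_le_sum (f := fun a => f (some a)) (fun _ _ => Nat.zero_le _) ha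
        omega
      · by_contra h
        exact ha (by simpa using hf.2 (some a) (by omega))
    have hsum : ∑ a, f (some a) = ∑ a ∈ W, f (some a) := by
      symm
      apply Finset.sum_subset (Finset.subset_univ _)
      intro a _ ha
      by_contra h
      exact ha (by simpa using hf.2 (some a) h)
    refine ⟨⟨fun a => ⟨f (some a), Nat.lt_succ_of_le (hle a)⟩, ?_⟩, ?_, ?_⟩
    · simp only [hsum]; omega
    · rw [Finset.mem_filter]
      refine ⟨Finset.mem_univ _, fun a ha => ?_⟩
      rw [mem_supp] at ha
      have : f (some a) ≠ 0 := fun h0 => ha (Fin.ext h0)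
      simpa using hf.2 (some a) this
    · funext o
      rcases o with _ | a
      · simp only [Option.elim, hsum]; omega
      · rfl

theorem card_eq : Fintype.card (AttMonomial d g) = (d + g).choose g := by
  have := card_supp_subset (g := g) (Finset.univ : Finset (Fin d))
  simpa using this

end AttMonomial

/-! ## Pebblings as sequences of configurations -/

/-- Values may be discarded and recomputed, so only the last time at which an operand is aggregated
is meaningful; this locates it. -/
theorem exists_last_false {P : ℕ → Prop} (h0 : ¬ P 0) {T : ℕ} (hT : P T) :
    ∃ t < T, ¬ P t ∧ ∀ s, t < s → s ≤ T → P s := by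
  induction T with
  | zero => exact absurd hT h0
  | succ T ih =>
    by_cases h : P T
    · obtain ⟨t, ht, h1, h2⟩ := ih h
      refine ⟨t, by omega, h1, fun s hs hs' => ?_⟩
      rcases Nat.lt_or_ge s (T + 1) with h' | h'
      · exact h2 s hs (by omega)
      · rwa [show s = T + 1 by omega]
    · refine ⟨T, by omega, h, fun s hs hs' => ?_⟩
      rwa [show s = T + 1 by omega]

namespace CompDAG

variable {V : Type} [DecidableEq V] {G : CompDAG V} {M N : ℕ}

theorem Step.cost_le_one {c c' : PebbleConfig V} {k : ℕ} (h : G.Step c c' k) : k ≤ 1 := by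
  cases h <;> simp

/-- The effect of a step on the individual values; `T` holds the value that is transferred between
the memories, if any. -/
theorem Step.effect {c c' : PebbleConfig V} {k : ℕ} (h : G.Step c c' k) :
    ∃ T : Finset V, T.card ≤ k ∧ ∀ v,
      (v ∈ c'.blue → v ∉ c.blue → v ∈ T) ∧
      ((c'.agg v = c.agg v ∧ (v ∈ c.red ∨ v ∈ c.blue → v ∈ c'.red ∨ v ∈ c'.blue) ∧
          (v ∈ c'.red → v ∈ c.red ∨ v ∈ T)) ∨
        (∃ u ∈ G.pred v, u ∈ c.red ∧ G.Complete c u ∧ (v ∈ c.red ∨ v ∉ c.blue) ∧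
          c'.agg v = insert u (c.agg v) ∧ v ∈ c'.red ∧ v ∉ c'.blue) ∨
        (c'.agg v = ∅ ∧ v ∉ c'.red ∧ v ∉ c'.blue)) := by
  cases h with
  | load w hw =>
    refine ⟨{w}, by simp, fun v => ⟨fun h h' => absurd h h', Or.inl ?_⟩⟩
    simp only [Finset.mem_insert, Finset.mem_singleton]
    tauto
  | save w hw =>
    refine ⟨{w}, by simp, fun v => ⟨?_, Or.inl ?_⟩⟩
    · simp only [Set.mem_insert_iff, Finset.mem_singleton]
      tauto
    · simp only [Set.mem_insert_iff, Finset.mem_singleton]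
      tauto
  | compute u w huw hu hcomp hw hnew =>
    refine ⟨∅, by simp, fun v => ⟨by simp only [Set.mem_sdiff]; tauto, ?_⟩⟩
    by_cases hvw : v = w
    · subst hvw
      exact Or.inr (Or.inl ⟨u, huw, hu, hcomp, hw, by simp, by simp, by simp⟩)
    · left
      simp [hvw]
  | evict w hw =>
    refine ⟨∅, by simp, fun v => ⟨by simp, Or.inl ?_⟩⟩
    by_cases hvw : v = w
    · subst hvw
      simp [hw]
    · simp [hvw]
  | discard w =>
    refine ⟨∅, by simp, fun v => ⟨by simp only [Set.mem_sdiff]; tauto, ?_⟩⟩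
    by_cases hvw : v = w
    · subst hvw
      right; right
      simp
    · left
      simp [hvw]

/-- A sequence of configurations in which each arises from the previous one by a step. -/
structure IsRun (G : CompDAG V) (M N : ℕ) (conf : ℕ → PebbleConfig V) (cost : ℕ → ℕ) : Prop where
  step : ∀ t < N, G.Step (conf t) (conf (t + 1)) (cost t)
  card_red : ∀ t ≤ N, (conf t).red.card ≤ M
  init : conf 0 = G.initial

theorem Reaches.exists_run {c c' : PebbleConfig V} {k : ℕ} (h : G.Reaches M c c' k)
    (hc : c = G.initial) :
    ∃ N conf cost, G.IsRun M N conf cost ∧ conf N = c' ∧ ∑ t ∈ Finset.range N, cost t = k := by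
  induction h with
  | refl =>
    refine ⟨0, fun _ => c, fun _ => 0, ⟨by simp, fun t _ => ?_, hc⟩, rfl, by simp⟩
    simp [hc, initial]
  | @tail c₁ c₂ k s h hs hM ih =>
    obtain ⟨N, conf, cost, hrun, hN, hk⟩ := ih
    refine ⟨N + 1, fun t => if t ≤ N then conf t else c₂, fun t => if t < N then cost t else s,
      ⟨fun t ht => ?_, fun t ht => ?_, ?_⟩, by simp, ?_⟩
    · rcases Nat.lt_or_ge t N with h' | h'
      · simpa [h', h'.le, Nat.succ_le_of_lt h'] using hrun.step t h'
      · obtain rfl : t = N := by omega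
        simpa [hN] using hs
    · by_cases h' : t ≤ N
      · simpa [h'] using hrun.card_red t h'
      · simpa [h'] using hM
    · simpa using hrun.init
    · rw [Finset.sum_range_succ, ← hk]
      simp only [lt_irrefl, if_false, Nat.add_right_cancel_iff]
      exact Finset.sum_congr rfl fun t ht => by simp [Finset.mem_range.1 ht]

/-- In the time interval `[a, b)`, the value of `v` is at some time available as an operand. -/
def Avail (G : CompDAG V) (conf : ℕ → PebbleConfig V) (a b : ℕ) (v : V) : Prop :=
  ∃ t, a ≤ t ∧ t < b ∧ v ∈ (conf t).red ∧ G.Complete (conf t) v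

/-- The set `R` contains every value which is not computed from scratch or not lost in the time
interval `[a, b)`. -/
structure IsResident (G : CompDAG V) (conf : ℕ → PebbleConfig V) (a b : ℕ) (R : Finset V) :
    Prop where
  avail : ∀ v, G.Avail conf a b v →
    v ∈ R ∨ (G.pred v).Nonempty ∧ ∀ u ∈ G.pred v, G.Avail conf a b u
  survive : ∀ u v t, a ≤ t → t < b → u ∉ (conf t).agg v →
    (∀ s, t < s → s ≤ b → u ∈ (conf s).agg v) → v ∈ R

/-! ### Resident values and division into phases -/

namespace IsRun

variable {conf : ℕ → PebbleConfig V} {cost : ℕ → ℕ}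

/-- Aggregation leaves a red pebble, eviction keeps a blue one, and the only step that can remove
the last pebble also clears `agg`. -/
theorem pebbled_of_agg_ne_empty (h : G.IsRun M N conf cost) {t : ℕ} (ht : t ≤ N) {v : V}
    (hv : (conf t).agg v ≠ ∅) : v ∈ (conf t).red ∨ v ∈ (conf t).blue := by
  induction t with
  | zero => simp [h.init, initial] at hv
  | succ t ih =>
    obtain ⟨T, -, hT⟩ := (h.step t (by omega)).effect
    rcases (hT v).2 with ⟨h1, h2, -⟩ | ⟨u, -, -, -, -, -, h1, -⟩ | ⟨h1, -, -⟩
    · exact h2 (ih (by omega) (h1 ▸ hv))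
    · exact Or.inl h1
    · exact absurd h1 hv

/-- The resident set consists of the values red at `a`, the values red at `b`, and those loaded or
saved in between; this explains `2 * M` plus the cost. -/
theorem exists_isResident (h : G.IsRun M N conf cost) {a b : ℕ} (hab : a ≤ b) (hb : b ≤ N) :
    ∃ R : Finset V, R.card ≤ 2 * M + ∑ t ∈ Finset.Ico a b, cost t ∧ G.IsResident conf a b R := by
  have heff : ∀ t, ∃ T : Finset V, t < N → T.card ≤ cost t ∧ ∀ v,
      (v ∈ (conf (t + 1)).blue → v ∉ (conf t).blue → v ∈ T) ∧
      (((conf (t + 1)).agg v = (conf t).agg v ∧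
          (v ∈ (conf t).red ∨ v ∈ (conf t).blue →
            v ∈ (conf (t + 1)).red ∨ v ∈ (conf (t + 1)).blue) ∧
          (v ∈ (conf (t + 1)).red → v ∈ (conf t).red ∨ v ∈ T)) ∨
        (∃ u ∈ G.pred v, u ∈ (conf t).red ∧ G.Complete (conf t) u ∧
          (v ∈ (conf t).red ∨ v ∉ (conf t).blue) ∧
          (conf (t + 1)).agg v = insert u ((conf t).agg v) ∧ v ∈ (conf (t + 1)).red ∧
          v ∉ (conf (t + 1)).blue) ∨
        ((conf (t + 1)).agg v = ∅ ∧ v ∉ (conf (t + 1)).red ∧ v ∉ (conf (t + 1)).blue)) := by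
    intro t
    by_cases ht : t < N
    · obtain ⟨T, hT⟩ := (h.step t ht).effect
      exact ⟨T, fun _ => hT⟩
    · exact ⟨∅, fun h => absurd h ht⟩
  choose T hT using heff
  refine ⟨(conf a).red ∪ (conf b).red ∪ (Finset.Ico a b).biUnion T, ?_, ?_, ?_⟩
  · refine (Finset.card_union_le _ _).trans (add_le_add ?_ ?_)
    · refine (Finset.card_union_le _ _).trans ?_
      have := h.card_red a (by omega)
      have := h.card_red b hb
      omega
    · refine Finset.card_biUnion_le.trans (Finset.sum_le_sum fun t ht => ?_)
      rw [Finset.mem_Ico] at ht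
      exact (hT t (by omega)).1
  · rintro v ⟨t₁, ha₁, hb₁, hred₁, hcomp₁⟩
    by_contra hcon
    rw [not_or] at hcon
    obtain ⟨hR, hcon⟩ := hcon
    simp only [Finset.mem_union, not_or, Finset.mem_biUnion, Finset.mem_Ico, not_exists,
      not_and] at hR
    -- As `v` is not red at time `a` and is never loaded, any red pebble on it stems from
    -- aggregations inside the interval, starting from nothing.
    have key : ∀ t, a ≤ t → t < b → v ∈ (conf t).red →
        (G.pred v).Nonempty ∧ ∀ u ∈ (conf t).agg v, G.Avail conf a b u := by
      intro t hat
      induction t, hat using Nat.le_induction with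
      | base => exact fun _ hv => absurd hv hR.1.1
      | succ t hat ih =>
        intro htb hv
        have htouch : v ∉ T t := hR.2 t ⟨hat, by omega⟩
        rcases ((hT t (by omega)).2 v).2 with
          ⟨h1, -, h3⟩ | ⟨u, hu, h1, h2, h3, h4, -, -⟩ | ⟨-, h1, -⟩
        · rw [h1]
          exact ih (by omega) ((h3 hv).resolve_right htouch)
        · refine ⟨⟨u, hu⟩, fun w hw => ?_⟩
          rw [h4, Finset.mem_insert] at hw
          rcases hw with rfl | hw
          · exact ⟨t, hat, by omega, h1, h2⟩
          · by_cases hvr : v ∈ (conf t).red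
            · exact (ih (by omega) hvr).2 w hw
            -- An aggregation into a value that is not red requires it not to be blue either, hence
            -- to have nothing aggregated before; so this case is contradictory.
            · have := h.pebbled_of_agg_ne_empty (t := t) (by omega) (v := v)
                (Finset.ne_empty_of_mem hw)
              tauto
        · exact absurd hv h1
    have := key t₁ ha₁ hb₁ hred₁
    rw [hcomp₁] at this
    exact hcon this
  · intro u v t hat htb hu hagg
    by_contra hR
    simp only [Finset.mem_union, not_or, Finset.mem_biUnion, Finset.mem_Ico, not_exists,
      not_and] at hR
    -- The aggregation at time `t` invalidates the copy in slow memory, and a later save would count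
    -- as a transfer of `v`.
    have hblue : ∀ s, t + 1 ≤ s → s ≤ b → v ∉ (conf s).blue := by
      intro s hs
      induction s, hs using Nat.le_induction with
      | base =>
        intro _
        have hmem := hagg (t + 1) (by omega) (by omega)
        rcases ((hT t (by omega)).2 v).2 with ⟨h1, -, -⟩ | ⟨-, -, -, -, -, -, -, h1⟩ | ⟨-, -, h1⟩
        · exact absurd (h1 ▸ hmem) hu
        · exact h1
        · exact h1
      | succ s hs ih =>
        intro hsb hv
        exact hR.2 s ⟨by omega, by omega⟩ (((hT s (by omega)).2 v).1 hv (ih (by omega)))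
    rcases h.pebbled_of_agg_ne_empty hb (Finset.ne_empty_of_mem (hagg b htb le_rfl)) with h' | h'
    · exact hR.1.2 h'
    · exact hblue b (by omega) le_rfl h'

/-- Taking the last time before `T` at which `u` is missing, the next step must be the one that
aggregates it, since no other step enlarges `agg`. -/
theorem exists_aggregation (h : G.IsRun M N conf cost) {T : ℕ} (hT : T ≤ N) {u v : V}
    (hu : u ∈ (conf T).agg v) :
    ∃ t < T, u ∉ (conf t).agg v ∧ (∀ s, t < s → s ≤ T → u ∈ (conf s).agg v) ∧
      u ∈ (conf t).red ∧ G.Complete (conf t) u := by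
  obtain ⟨t, htT, h1, h2⟩ :=
    exists_last_false (P := fun t => u ∈ (conf t).agg v) (by simp [h.init, initial]) hu
  refine ⟨t, htT, h1, h2, ?_⟩
  obtain ⟨T, -, hT⟩ := (h.step t (by omega)).effect
  have hmem := h2 (t + 1) (by omega) (by omega)
  rcases (hT v).2 with ⟨h3, -, -⟩ | ⟨w, -, h3, h4, -, h5, -, -⟩ | ⟨h3, -, -⟩
  · exact absurd (h3 ▸ hmem) h1
  · rw [h5, Finset.mem_insert] at hmem
    obtain rfl := hmem.resolve_right h1
    exact ⟨h3, h4⟩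
  · simp [h3] at hmem

/-- If `v` is an operand of a sink `w` and `u` is an operand of `v`, then there is a time at which
`u` is available, and such that, in every time interval that contains it, one of `v` and `w` is
resident. -/
theorem exists_useful_time (h : G.IsRun M N conf cost) (hfin : G.IsFinal (conf N)) {u v w : V}
    (huv : u ∈ G.pred v) (hvw : v ∈ G.pred w) (hw : G.IsSink w) :
    ∃ t < N, ∀ a b R, a ≤ t → t < b → b ≤ N → G.IsResident conf a b R →
      G.Avail conf a b u ∧ (v ∈ R ∨ w ∈ R) := by
  have hv : v ∈ (conf N).agg w := by
    have := (hfin w hw).2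
    rw [Complete] at this
    rwa [this]
  obtain ⟨t₁, ht₁, hv1, hv2, -, hv4⟩ := h.exists_aggregation le_rfl hv
  have hu : u ∈ (conf t₁).agg v := by
    rw [Complete] at hv4
    rwa [hv4]
  obtain ⟨t, ht, hu1, hu2, hu3, hu4⟩ := h.exists_aggregation ht₁.le hu
  refine ⟨t, by omega, fun a b R hat htb hbN hR => ⟨⟨t, hat, htb, hu3, hu4⟩, ?_⟩⟩
  -- Here `t` is the last aggregation of `u` into `v` before `v` itself is aggregated into `w` for
  -- good at `t₁`. If `t₁` lies in the interval, `w` survives its end; otherwise the partial value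
  -- of `v` does.
  rcases Nat.lt_or_ge t₁ b with h' | h'
  · exact Or.inr (hR.survive v w t₁ (by omega) h' hv1 fun s hs hs' => hv2 s hs (by omega))
  · exact Or.inl (hR.survive u v t hat htb hu1 fun s hs hs' => hu2 s hs (by omega))

/-- If in each phase of cost at most `X` at most `B` useful aggregations of the family `u` can take
place, then a pebbling has at least `card ι / B - 1` phases. -/
theorem card_le_of_phase_bound (h : G.IsRun M N conf cost) {ι : Type} [Fintype ι] {X B : ℕ}
    (hX : 1 ≤ X) {P : ι → ℕ → ℕ → Finset V → Prop}
    (hP : ∀ e, ∃ t < N, ∀ a b R, a ≤ t → t < b → b ≤ N → G.IsResident conf a b R → P e a b R)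
    (hB : ∀ a b R, R.card ≤ 2 * M + X → G.IsResident conf a b R → ∀ F : Finset ι,
      (∀ e ∈ F, P e a b R) → F.card ≤ B) :
    Fintype.card ι ≤ ((∑ t ∈ Finset.range N, cost t) / X + 1) * B := by
  classical
  choose τ hτN hτ using hP
  set cum : ℕ → ℕ := fun t => ∑ s ∈ Finset.range t, cost s with hcum
  have hmono : Monotone cum := fun s t hst =>
    Finset.sum_le_sum_of_subset (Finset.range_mono hst)
  -- The phase of `e` is the cost spent before its time `τ e`, divided by `X`.
  have hmaps : ∀ e ∈ (Finset.univ : Finset ι),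
      cum (τ e) / X ∈ Finset.range ((∑ t ∈ Finset.range N, cost t) / X + 1) := by
    intro e _
    rw [Finset.mem_range, Nat.lt_succ_iff]
    exact Nat.div_le_div_right (hmono (hτN e).le)
  have := Finset.card_le_mul_card_image_of_maps_to hmaps B ?_
  · simpa [mul_comm] using this
  intro p _
  set F := Finset.univ.filter fun e => cum (τ e) / X = p with hF
  rcases F.eq_empty_or_nonempty with hemp | hne
  · simp [hemp]
  have hneI : (F.image τ).Nonempty := hne.image τ
  -- The interval is shrunk to the span of the useful times of this phase.
  set a := (F.image τ).min' hneI with ha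
  set b := (F.image τ).max' hneI + 1 with hbdef
  obtain ⟨e₁, he₁, hae⟩ := Finset.mem_image.1 ((F.image τ).min'_mem hneI)
  obtain ⟨e₂, he₂, hbe⟩ := Finset.mem_image.1 ((F.image τ).max'_mem hneI)
  have hmem : ∀ e ∈ F, a ≤ τ e ∧ τ e < b := fun e he =>
    ⟨Finset.min'_le _ _ (Finset.mem_image_of_mem τ he),
      Nat.lt_succ_of_le (Finset.le_max' _ _ (Finset.mem_image_of_mem τ he))⟩
  have hab : a ≤ b := ((hmem e₁ he₁).1.trans (hmem e₁ he₁).2.le)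
  have hbN : b ≤ N := by
    rw [hbdef, ← hbe]
    exact hτN e₂
  have hcost : ∑ t ∈ Finset.Ico a b, cost t ≤ X := by
    have h1 : cum a + ∑ t ∈ Finset.Ico a b, cost t = cum b := by
      simp only [hcum, Finset.range_eq_Ico]
      exact Finset.sum_Ico_consecutive _ (Nat.zero_le _) hab
    -- The last step may itself cost `1`. Since `cum (τ e₂)` is strictly below `(p + 1) * X`,
    -- including that step still keeps the total within `X`.
    have h2 : cum b = cum (τ e₂) + cost (τ e₂) := by
      rw [hbdef, ← hbe]
      exact Finset.sum_range_succ _ _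
    have h3 : cost (τ e₂) ≤ 1 := (h.step _ (hτN e₂)).cost_le_one
    have h4 : cum (τ e₂) / X = p := (Finset.mem_filter.1 he₂).2
    have h5 : cum a / X = p := by
      rw [ha, ← hae]
      exact (Finset.mem_filter.1 he₁).2
    have h6 : cum (τ e₂) < (p + 1) * X := by
      rw [← h4]
      have := Nat.lt_mul_div_succ (cum (τ e₂)) (show 0 < X by omega)
      linarith [mul_comm X (cum (τ e₂) / X + 1)]
    have h7 : p * X ≤ cum a := by
      rw [← h5]
      exact Nat.div_mul_le_self _ _
    have h8 : (p + 1) * X = p * X + X := by ring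
    omega
  obtain ⟨R, hRcard, hR⟩ := h.exists_isResident hab hbN
  exact hB a b R (by omega) hR F fun e he => hτ e a b R (hmem e he).1 (hmem e he).2 hbN hR

end IsRun

end CompDAG

/-! ## The number of useful products in a phase -/

theorem Finset.sum_card_filter_eq_some_le {α β : Type*} [Fintype β] [DecidableEq β] (R : Finset α)
    (f : α → Option β) : ∑ b, (R.filter fun v => f v = some b).card ≤ R.card := by
  have h := Finset.card_eq_sum_card_fiberwise (s := R) (t := Finset.univ) (f := f) (by simp)
  rw [Fintype.sum_option] at h
  omega

namespace AttNode

variable {n d g : ℕ}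

/-- The row of a node in the computation of `U₁ H` from `Q` and `H`. -/
def queryRow : AttNode n d g → Option (Fin n)
  | Q i _ | U₁ i _ | A i _ | out i _ => some i
  | _ => none

/-- The row of a node in the computation of `H` from `K` and `V`. -/
def keyRow : AttNode n d g → Option (Fin n)
  | V l _ | prodH _ l _ => some l
  | _ => none

/-- The column of an output node. -/
def outCol : AttNode n d g → Option (Fin d)
  | A _ j | out _ j => some j
  | _ => none

variable {R : Finset (AttNode n d g)} {Av : AttNode n d g → Prop} {μ : ℕ}

open Classical in
-- By averaging, some row `l` has at most `μ / n` resident values. An available `H m j` is resident,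
-- or its operand from row `l` is, or `V l j` is, as an input cannot be recomputed. The last case
-- allows all `r` monomials per `j`, but `r ≤ n` compensates for this.
theorem card_avail_H_le
    (hAv : ∀ v, Av v → v ∈ R ∨ (operands v).Nonempty ∧ ∀ u ∈ operands v, Av u)
    (hR : R.card ≤ μ) (hn : (d + g).choose g ≤ n) :
    (Finset.univ.filter fun p : AttMonomial d g × Fin d => Av (H p.1 p.2)).card ≤ 3 * μ := by
  have hrpos : 0 < (d + g).choose g := Nat.choose_pos (by omega)
  set ρ : Fin n → ℕ := fun l => (R.filter fun v => keyRow v = some l).card with hρ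
  have hsum : ∑ l, ρ l ≤ μ := (Finset.sum_card_filter_eq_some_le R keyRow).trans hR
  obtain ⟨l, hl⟩ : ∃ l, n * ρ l ≤ μ := by
    by_contra! hcon
    have hne : (Finset.univ : Finset (Fin n)).Nonempty := ⟨⟨0, by omega⟩, Finset.mem_univ _⟩
    have h1 : ∑ l : Fin n, μ < ∑ l, n * ρ l :=
      Finset.sum_lt_sum_of_nonempty hne fun l _ => hcon l
    rw [← Finset.mul_sum] at h1
    simp only [Finset.sum_const, Finset.card_univ, Fintype.card_fin, smul_eq_mul] at h1
    exact absurd (Nat.mul_le_mul_left n hsum) (by omega)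
  have hsub : (Finset.univ.filter fun p : AttMonomial d g × Fin d => Av (H p.1 p.2)) ⊆
      (Finset.univ.filter fun p : AttMonomial d g × Fin d => H p.1 p.2 ∈ R) ∪
      (Finset.univ.filter fun p : AttMonomial d g × Fin d => prodH p.1 l p.2 ∈ R) ∪
      Finset.univ ×ˢ (Finset.univ.filter fun j : Fin d => V l j ∈ R) := by
    rintro ⟨m, j⟩ hp
    simp only [Finset.mem_filter, Finset.mem_univ, true_and, Finset.mem_union,
      Finset.mem_product] at hp ⊢
    rcases hAv _ hp with h | ⟨-, h⟩
    · exact Or.inl (Or.inl h)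
    rcases hAv (prodH m l j) (h _ (by simp [operands])) with h | ⟨-, h⟩
    · exact Or.inl (Or.inr h)
    rcases hAv (V l j) (h _ (by simp [operands])) with h | ⟨h, -⟩
    · exact Or.inr h
    · simp [operands] at h
  have h1 : (Finset.univ.filter fun p : AttMonomial d g × Fin d => H p.1 p.2 ∈ R).card
      ≤ R.card :=
    Finset.card_le_card_of_injOn (fun p => H p.1 p.2) (fun p hp => by simpa using hp)
      (fun p _ q _ h => by simp only [H.injEq] at h; exact Prod.ext h.1 h.2)
  have h2 : (Finset.univ.filter fun p : AttMonomial d g × Fin d => prodH p.1 l p.2 ∈ R).card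
      ≤ ρ l :=
    Finset.card_le_card_of_injOn (fun p => prodH p.1 l p.2)
      (fun p hp => Finset.mem_coe.2 (Finset.mem_filter.2 ⟨(Finset.mem_filter.1 hp).2, rfl⟩))
      (fun p _ q _ h => by simp only [prodH.injEq] at h; exact Prod.ext h.1 h.2.2)
  have h3 : (Finset.univ.filter fun j : Fin d => V l j ∈ R).card ≤ ρ l :=
    Finset.card_le_card_of_injOn (fun j => V l j)
      (fun p hp => Finset.mem_coe.2 (Finset.mem_filter.2 ⟨(Finset.mem_filter.1 hp).2, rfl⟩))
      (fun p _ q _ h => by simpa using h)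
  calc _ ≤ _ := Finset.card_le_card hsub
    _ ≤ R.card + ρ l + n * ρ l := by
      refine (Finset.card_union_le _ _).trans (add_le_add
        ((Finset.card_union_le _ _).trans (add_le_add h1 h2)) ?_)
      -- There are `r` pairs for each resident `V l j`, and `r * ρ l ≤ n * ρ l ≤ μ`.
      rw [Finset.card_product, Finset.card_univ, AttMonomial.card_eq]
      exact Nat.mul_le_mul hn h3
    _ ≤ 3 * μ := by
      have : ρ l ≤ n * ρ l := Nat.le_mul_of_pos_left _ (by omega)
      omega

open Classical in
-- Rows are split according to whether they have at least `s` resident values. Rows above the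
-- threshold are limited by the available entries of `H`, rows below it by the few columns and
-- variables they have. The term `s * μ` accounts for products that are resident themselves.
theorem card_useful_le
    (hAv : ∀ v, Av v → v ∈ R ∨ (operands v).Nonempty ∧ ∀ u ∈ operands v, Av u)
    (hR : R.card ≤ μ) (hn : (d + g).choose g ≤ n) (s : ℕ)
    (F : Finset (Fin n × AttMonomial d g × Fin d))
    (hF : ∀ e ∈ F, Av (prodA e.1 e.2.1 e.2.2) ∧ (A e.1 e.2.2 ∈ R ∨ out e.1 e.2.2 ∈ R)) :
    s * F.card ≤ s * μ + 3 * μ ^ 2 + s * (s + (s + g).choose g) * μ := by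
  have hH := card_avail_H_le hAv hR hn
  set Hs := Finset.univ.filter fun p : AttMonomial d g × Fin d => Av (H p.1 p.2) with hHs
  set Ri : Fin n → Finset (AttNode n d g) := fun i => R.filter fun v => queryRow v = some i
    with hRi
  set ρ : Fin n → ℕ := fun i => (Ri i).card with hρ
  have hsum : ∑ i, ρ i ≤ μ := (Finset.sum_card_filter_eq_some_le R queryRow).trans hR
  set F₀ := F.filter fun e => prodA e.1 e.2.1 e.2.2 ∈ R with hF₀
  set F₁ := F.filter fun e => prodA e.1 e.2.1 e.2.2 ∉ R with hF₁
  have hcard : F.card = F₀.card + F₁.card :=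
    (Finset.card_filter_add_card_filter_not _).symm
  have hF₀card : F₀.card ≤ μ := by
    refine le_trans (Finset.card_le_card_of_injOn (t := R) (fun e => prodA e.1 e.2.1 e.2.2)
      (fun e he => (Finset.mem_filter.1 he).2) (fun p _ q _ h => ?_)) hR
    simp only [prodA.injEq] at h
    exact Prod.ext h.1 (Prod.ext h.2.1 h.2.2)
  have hF₁mem : ∀ e ∈ F₁, Av (U₁ e.1 e.2.1) ∧ Av (H e.2.1 e.2.2) ∧
      (A e.1 e.2.2 ∈ R ∨ out e.1 e.2.2 ∈ R) := by
    intro e he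
    rw [hF₁, Finset.mem_filter] at he
    obtain ⟨h1, h2⟩ := hF e he.1
    have := (hAv _ h1).resolve_left he.2
    exact ⟨this.2 _ (by simp [operands]), this.2 _ (by simp [operands]), h2⟩
  set f : Fin n → ℕ := fun i => (F₁.filter fun e => e.1 = i).card with hf
  have hF₁card : F₁.card = ∑ i, f i :=
    Finset.card_eq_sum_card_fiberwise (f := Prod.fst) (t := Finset.univ) (by simp)
  have hheavy : ∀ i, f i ≤ 3 * μ := by
    intro i
    refine le_trans (Finset.card_le_card_of_injOn (fun e => e.2) (fun e he => ?_) ?_) hH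
    · have := (hF₁mem e (Finset.mem_filter.1 he).1).2.1
      simpa [hHs] using this
    · intro e he e' he' h
      have h1 := (Finset.mem_filter.1 he).2
      have h2 := (Finset.mem_filter.1 he').2
      exact Prod.ext (h1.trans h2.symm) h
  have hlight : ∀ i, f i ≤ ρ i * (ρ i + (ρ i + g).choose g) := by
    intro i
    set Js := Finset.univ.filter fun j : Fin d => A i j ∈ R ∨ out i j ∈ R with hJs
    set Us := Finset.univ.filter fun m : AttMonomial d g => U₁ i m ∈ R with hUs
    set Ss := Finset.univ.filter fun a : Fin d => Q i a ∈ R with hSs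
    set Ms := Finset.univ.filter fun m : AttMonomial d g => m.supp ⊆ Ss with hMs
    have hJ : Js.card ≤ ρ i := by
      -- A column counts once whether it is witnessed by `A i j` or by the output, as `outCol` sends
      -- both to `j`; so no factor `2` is lost.
      rw [← Finset.card_image_of_injective Js (Option.some_injective _)]
      refine (Finset.card_le_card ?_).trans (Finset.card_image_le (s := Ri i) (f := outCol))
      intro o ho
      obtain ⟨j, hj, rfl⟩ := Finset.mem_image.1 ho
      rcases (Finset.mem_filter.1 hj).2 with h | h
      · exact Finset.mem_image.2 ⟨_, Finset.mem_filter.2 ⟨h, rfl⟩, rfl⟩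
      · exact Finset.mem_image.2 ⟨_, Finset.mem_filter.2 ⟨h, rfl⟩, rfl⟩
    have hU : Us.card ≤ ρ i :=
      Finset.card_le_card_of_injOn (fun m => U₁ i m)
        (fun p hp => Finset.mem_coe.2 (Finset.mem_filter.2 ⟨(Finset.mem_filter.1 hp).2, rfl⟩))
        (fun p _ q _ h => by simpa using h)
    have hS : Ss.card ≤ ρ i :=
      Finset.card_le_card_of_injOn (fun a => Q i a)
        (fun p hp => Finset.mem_coe.2 (Finset.mem_filter.2 ⟨(Finset.mem_filter.1 hp).2, rfl⟩))
        (fun p _ q _ h => by simpa using h)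
    have hM : Ms.card ≤ (ρ i + g).choose g := by
      rw [hMs, AttMonomial.card_supp_subset]
      exact Nat.choose_le_choose _ (by omega)
    calc f i ≤ (Js ×ˢ (Us ∪ Ms)).card := by
          refine Finset.card_le_card_of_injOn (fun e => (e.2.2, e.2.1)) (fun e he => ?_) ?_
          · obtain ⟨he1, rfl⟩ := Finset.mem_filter.1 he
            obtain ⟨h1, h2, h3⟩ := hF₁mem e he1
            rw [Finset.mem_coe, Finset.mem_product, Finset.mem_union]
            refine ⟨Finset.mem_filter.2 ⟨Finset.mem_univ _, h3⟩, ?_⟩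
            rcases hAv _ h1 with h | ⟨-, h⟩
            · exact Or.inl (Finset.mem_filter.2 ⟨Finset.mem_univ _, h⟩)
            · refine Or.inr (Finset.mem_filter.2 ⟨Finset.mem_univ _, fun a ha => ?_⟩)
              have hQ : Av (Q e.1 a) := h _ (by
                rw [AttMonomial.mem_supp] at ha
                simpa [operands] using ha)
              rcases hAv _ hQ with h | ⟨h, -⟩
              · exact Finset.mem_filter.2 ⟨Finset.mem_univ _, h⟩
              · simp [operands] at h
          · intro e he e' he' h
            have h1 := (Finset.mem_filter.1 he).2
            have h2 := (Finset.mem_filter.1 he').2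
            simp only [Prod.mk.injEq] at h
            exact Prod.ext (h1.trans h2.symm) (Prod.ext h.2 h.1)
      _ ≤ ρ i * (ρ i + (ρ i + g).choose g) := by
          rw [Finset.card_product]
          exact Nat.mul_le_mul hJ ((Finset.card_union_le _ _).trans (add_le_add hU hM))
  have hrow : ∀ i, s * f i ≤ ρ i * (3 * μ) + s * (s + (s + g).choose g) * ρ i := by
    intro i
    -- For `s ≤ ρ i` the bound `3 * μ` is charged to the `ρ i` resident values, whose sum over all
    -- rows is at most `μ`.
    rcases le_total s (ρ i) with h | h
    · exact (Nat.mul_le_mul h (hheavy i)).trans (Nat.le_add_right _ _)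
    · have h1 : (ρ i + g).choose g ≤ (s + g).choose g := Nat.choose_le_choose _ (by omega)
      calc s * f i ≤ s * (ρ i * (s + (s + g).choose g)) :=
            Nat.mul_le_mul_left _ ((hlight i).trans (Nat.mul_le_mul_left _ (add_le_add h h1)))
        _ = s * (s + (s + g).choose g) * ρ i := by ring
        _ ≤ _ := Nat.le_add_left _ _
  have h₁ : s * F₁.card ≤ 3 * μ ^ 2 + s * (s + (s + g).choose g) * μ := by
    rw [hF₁card, Finset.mul_sum]
    refine (Finset.sum_le_sum fun i _ => hrow i).trans ?_
    rw [Finset.sum_add_distrib, ← Finset.sum_mul, ← Finset.mul_sum]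
    refine add_le_add ?_ (Nat.mul_le_mul_left _ hsum)
    calc (∑ i, ρ i) * (3 * μ) ≤ μ * (3 * μ) := Nat.mul_le_mul_right _ hsum
      _ = 3 * μ ^ 2 := by ring
  rw [hcard, mul_add]
  have := Nat.mul_le_mul_left s hF₀card
  omega

theorem isSink_out (i : Fin n) (j : Fin d) : (attentionDAG n d g).IsSink (out i j) := by
  intro w
  cases w <;> simp [attentionDAG, operands]

end AttNode

/-- The lower bound, in terms of a parameter `s`, the number of variables for which all monomials
can be held in fast memory together with `s` columns. -/
theorem attention_cost_lower {n d g M k s : ℕ} (hn : (d + g).choose g ≤ n) (hM : 1 ≤ M)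
    (hs1 : 1 ≤ s) (hs2 : s ^ 2 ≤ M) (hs : s * (s + g).choose g ≤ M)
    (hk : k ∈ (attentionDAG n d g).ioCosts M) :
    s * (n * (d + g).choose g * d) ≤ 36 * M * (k + M) := by
  classical
  obtain ⟨c, hfin, hreach⟩ := hk
  obtain ⟨N, conf, cost, hrun, rfl, rfl⟩ := hreach.exists_run rfl
  set k := ∑ t ∈ Finset.range N, cost t
  have hcount := hrun.card_le_of_phase_bound (ι := Fin n × AttMonomial d g × Fin d) (X := M)
    (B := 36 * M ^ 2 / s)
    (P := fun e a b R => (attentionDAG n d g).Avail conf a b (.prodA e.1 e.2.1 e.2.2) ∧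
      (AttNode.A e.1 e.2.2 ∈ R ∨ AttNode.out e.1 e.2.2 ∈ R)) hM
    (fun e => hrun.exists_useful_time hfin (v := .A e.1 e.2.2)
      (by simp [attentionDAG, AttNode.operands]) (by simp [attentionDAG, AttNode.operands])
      (AttNode.isSink_out _ _))
    (fun a b R hR hres F hF => by
      rw [Nat.le_div_iff_mul_le (by omega), mul_comm]
      have hs3 : s ≤ M := le_trans (Nat.le_self_pow (by norm_num) s) hs2
      have := AttNode.card_useful_le (μ := 3 * M) hres.avail (by omega) hn s F hF
      -- With `μ = 3M` the summands are at most `3M²`, `27M²`, `3M²` and `3M²`, in total `36M²`.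
      nlinarith [Nat.mul_le_mul_right M hs3, Nat.mul_le_mul_right M hs2,
        Nat.mul_le_mul_right M hs])
  rw [Fintype.card_prod, Fintype.card_prod, AttMonomial.card_eq, Fintype.card_fin,
    Fintype.card_fin] at hcount
  calc s * (n * (d + g).choose g * d) = s * (n * ((d + g).choose g * d)) := by ring
    _ ≤ s * ((k / M + 1) * (36 * M ^ 2 / s)) := Nat.mul_le_mul_left _ hcount
    _ = (k / M + 1) * (s * (36 * M ^ 2 / s)) := by ring
    _ ≤ (k / M + 1) * (36 * M ^ 2) := Nat.mul_le_mul_left _ (Nat.mul_div_le _ _)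
    _ = 36 * M * (M * (k / M) + M) := by ring
    _ ≤ 36 * M * (k + M) := by
      gcongr
      exact Nat.mul_div_le _ _

/-! ## A program logic for pebblings -/

/-- What is known about the value of a node at some point of a pebbling:
* `idle`: it is not in fast memory;
* `stored X`: it is in slow memory only, with the operands `X` aggregated;
* `cached X`: it is in both memories;
* `held X`: it is in fast memory;
* `ready X`: further operands can be aggregated into it;
* `retired X`: it is not in fast memory, and in slow memory if it has been started. -/
inductive PebbleStatus (V : Type)
  | idle
  | stored (X : Finset V)
  | cached (X : Finset V)
  | held (X : Finset V)
  | ready (X : Finset V)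
  | retired (X : Finset V)

namespace PebbleStatus

variable {V : Type}

/-- The meaning of a status, for a value that is red if `r`, is blue if `b`, and has `X`
aggregated. -/
def Holds : PebbleStatus V → Prop → Prop → Finset V → Prop
  | idle, r, _, _ => ¬ r
  | stored Y, r, b, X => ¬ r ∧ b ∧ X = Y
  | cached Y, r, b, X => r ∧ b ∧ X = Y
  | held Y, r, _, X => r ∧ X = Y
  | ready Y, r, b, X => X = Y ∧ (r ∨ ¬ b ∧ Y = ∅)
  | retired Y, r, b, X => ¬ r ∧ X = Y ∧ (Y ≠ ∅ → b)

/-- The status allows that the value is in fast memory. -/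
def InFast : PebbleStatus V → Prop
  | cached _ | held _ | ready _ => True
  | _ => False

/-- The value is in fast memory, with the operands `X` aggregated. -/
def IsOperand (X : Finset V) (s : PebbleStatus V) : Prop := s = cached X ∨ s = held X

theorem InFast.of_red {s : PebbleStatus V} {r b : Prop} {X : Finset V} (h : s.Holds r b X)
    (hr : r) : s.InFast := by
  cases s <;> simp_all [Holds, InFast]

/-- Changes of a status by a transfer between the memories. -/
inductive Transfer : PebbleStatus V → PebbleStatus V → Prop
  | load (X) : Transfer (stored X) (cached X)
  | evict (X) : Transfer (cached X) (stored X)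
  | bring (X) : Transfer (retired X) (ready X)
  | retire (X) : Transfer (ready X) (retired X)

/-- One status implies another. -/
def Entails (s s' : PebbleStatus V) : Prop := ∀ r b X, s.Holds r b X → s'.Holds r b X

theorem Entails.refl (s : PebbleStatus V) : s.Entails s := fun _ _ _ h => h

theorem stored_entails_idle (X : Finset V) : (stored X).Entails idle := fun _ _ _ h => h.1

theorem retired_entails_stored {X : Finset V} (hX : X.Nonempty) :
    (retired X).Entails (stored X) := fun _ _ _ h => ⟨h.1, h.2.2 hX.ne_empty, h.2.1⟩

/-- At most `M` values may be in fast memory. -/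
def Fits (S : V → PebbleStatus V) (M : ℕ) : Prop :=
  ∃ R : Finset V, R.card ≤ M ∧ ∀ v, (S v).InFast → v ∈ R

theorem Fits.mono {S : V → PebbleStatus V} {M M' : ℕ} (h : Fits S M) (hM : M ≤ M') :
    Fits S M' := by
  obtain ⟨R, hR, h⟩ := h
  exact ⟨R, hR.trans hM, h⟩

variable [DecidableEq V]

theorem Fits.update {S : V → PebbleStatus V} {M : ℕ} (h : Fits S M) (v : V)
    (s : PebbleStatus V) : Fits (Function.update S v s) (M + 1) := by
  obtain ⟨R, hR, h⟩ := h
  refine ⟨insert v R, (Finset.card_insert_le _ _).trans (by omega), fun w hw => ?_⟩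
  by_cases hwv : w = v
  · simp [hwv]
  · rw [Function.update_of_ne hwv] at hw
    exact Finset.mem_insert_of_mem (h w hw)

theorem Fits.update_of_inFast {S : V → PebbleStatus V} {M : ℕ} (h : Fits S M) {v : V}
    (hv : (S v).InFast) (s : PebbleStatus V) : Fits (Function.update S v s) M := by
  obtain ⟨R, hR, h⟩ := h
  refine ⟨R, hR, fun w hw => ?_⟩
  by_cases hwv : w = v
  · exact hwv ▸ h v hv
  · rw [Function.update_of_ne hwv] at hw
    exact h w hw

end PebbleStatus

namespace CompDAG

open PebbleStatus

variable {V : Type} {G : CompDAG V} {M : ℕ}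

/-- The configuration is described by `S`. -/
def Sat (S : V → PebbleStatus V) (c : PebbleConfig V) : Prop :=
  ∀ v, (S v).Holds (v ∈ c.red) (v ∈ c.blue) (c.agg v)

theorem Sat.card_red_le {S : V → PebbleStatus V} {c : PebbleConfig V} (h : Sat S c)
    (hS : Fits S M) : c.red.card ≤ M := by
  obtain ⟨R, hR, hRS⟩ := hS
  exact (Finset.card_le_card fun v hv => hRS v (.of_red (h v) hv)).trans hR

variable [DecidableEq V]

theorem Reaches.trans {c c' c'' : PebbleConfig V} {k k' : ℕ} (h : G.Reaches M c c' k)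
    (h' : G.Reaches M c' c'' k') : G.Reaches M c c'' (k + k') := by
  induction h' with
  | refl => exact h
  | tail _ hs hM ih => exact (add_assoc k _ _) ▸ ih.tail hs hM

theorem Reaches.single {c c' : PebbleConfig V} {k : ℕ} (h : G.Step c c' k)
    (hM : c'.red.card ≤ M) : G.Reaches M c c' k := by
  simpa using (Reaches.refl (G := G) (M := M) c).tail h hM

theorem Sat.update {S : V → PebbleStatus V} {c c' : PebbleConfig V} (h : Sat S c) {v : V}
    {s : PebbleStatus V} (hv : s.Holds (v ∈ c'.red) (v ∈ c'.blue) (c'.agg v))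
    (hne : ∀ w ≠ v, (w ∈ c'.red ↔ w ∈ c.red) ∧ (w ∈ c'.blue ↔ w ∈ c.blue) ∧
      c'.agg w = c.agg w) : Sat (Function.update S v s) c' := by
  intro w
  by_cases hwv : w = v
  · subst hwv
    simpa using hv
  · obtain ⟨h1, h2, h3⟩ := hne w hwv
    rw [Function.update_of_ne hwv, h1, h2, h3]
    exact h w

/-- From every configuration described by `S`, a configuration described by `S'` can be reached
at cost at most `k`. -/
def Can (G : CompDAG V) (M : ℕ) (S : V → PebbleStatus V) (k : ℕ) (S' : V → PebbleStatus V) :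
    Prop :=
  ∀ c, Sat S c → ∃ c' k', k' ≤ k ∧ G.Reaches M c c' k' ∧ Sat S' c'

/-! ### Rules of the program logic -/

namespace Can

variable {S S' S'' : V → PebbleStatus V} {k k' : ℕ}

theorem of_entails (h : ∀ v, (S v).Entails (S' v)) : G.Can M S 0 S' :=
  fun c hc => ⟨c, 0, le_rfl, .refl c, fun v => h v _ _ _ (hc v)⟩

theorem refl (S : V → PebbleStatus V) : G.Can M S 0 S := of_entails fun _ => .refl _

theorem trans (h : G.Can M S k S') (h' : G.Can M S' k' S'') : G.Can M S (k + k') S'' := by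
  intro c hc
  obtain ⟨c₁, k₁, hk₁, hr₁, hc₁⟩ := h c hc
  obtain ⟨c₂, k₂, hk₂, hr₂, hc₂⟩ := h' c₁ hc₁
  exact ⟨c₂, k₁ + k₂, by omega, hr₁.trans hr₂, hc₂⟩

theorem mono (h : G.Can M S k S') (hk : k ≤ k') : G.Can M S k' S' := by
  intro c hc
  obtain ⟨c₁, k₁, hk₁, h₁⟩ := h c hc
  exact ⟨c₁, k₁, hk₁.trans hk, h₁⟩

/-- The loop rule: `I t` is the invariant after the items of `t` have been processed, so the order
of processing is irrelevant. -/
theorem loop {α : Type*} [DecidableEq α] (s : Finset α) (I : Finset α → V → PebbleStatus V)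
    (h : ∀ t ⊆ s, ∀ a ∈ s, a ∉ t → G.Can M (I t) k (I (insert a t))) :
    G.Can M (I ∅) (s.card * k) (I s) := by
  suffices H : ∀ t ⊆ s, G.Can M (I ∅) (t.card * k) (I t) from H s subset_rfl
  intro t
  induction t using Finset.induction_on with
  | empty => exact fun _ => (refl _).mono (Nat.zero_le _)
  | insert a t ha ih =>
    intro hs
    have hts : t ⊆ s := (Finset.subset_insert a t).trans hs
    rw [Finset.card_insert_of_notMem ha, Nat.succ_mul]
    exact (ih hts).trans (h t hts a (hs (Finset.mem_insert_self a t)) ha)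

theorem drop (hS : Fits S M) (v : V) : G.Can M S 0 (Function.update S v idle) := by
  intro c hc
  refine ⟨_, 0, le_rfl, .single (.discard c v) ?_, hc.update ?_ ?_⟩
  · exact (Finset.card_le_card (Finset.erase_subset _ _)).trans (hc.card_red_le hS)
  · simp [Holds]
  · intro w hw
    simp [hw]

/-- Status `idle` leaves open what is in slow memory, so any old value of `p` is discarded before
its operands are aggregated one by one. The operands are already in fast memory, so this is free and
needs one more pebble. -/
theorem fresh {p : V} (hS : Fits S M) (hp : S p = idle) (hne : (G.pred p).Nonempty)
    (hops : ∀ u ∈ G.pred p, (S u).IsOperand (G.pred u)) :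
    G.Can (M + 1) S 0 (Function.update S p (held (G.pred p))) := by
  intro c hc
  have hpred : p ∉ c.red := by
    have := hc p
    rwa [hp] at this
  have hred := hc.card_red_le hS
  let cfg : Finset V → PebbleConfig V := fun T =>
    { red := if T = ∅ then c.red else insert p c.red
      blue := c.blue \ {p}
      agg := Function.update c.agg p T }
  have hop : ∀ u ∈ G.pred p, u ∈ c.red ∧ c.agg u = G.pred u ∧ u ≠ p := by
    intro u hu
    have := hc u
    have hup : u ≠ p := by
      rintro rfl
      rcases hops u hu with h | h <;> simp [hp] at h
    rcases hops u hu with h | h <;> rw [h] at this <;> simp only [Holds] at this <;> tauto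
  have key : ∀ T ⊆ G.pred p, G.Reaches (M + 1) c (cfg T) 0 := by
    intro T
    induction T using Finset.induction_on with
    | empty =>
      intro _
      have : cfg ∅ = ⟨c.red.erase p, c.blue \ {p}, Function.update c.agg p ∅⟩ := by
        simp [cfg, Finset.erase_eq_of_notMem hpred]
      rw [this]
      refine .single (.discard c p) ?_
      exact (Finset.card_le_card (Finset.erase_subset _ _)).trans (by omega)
    | insert u T hu ih =>
      intro hT
      have huP : u ∈ G.pred p := hT (Finset.mem_insert_self u T)
      obtain ⟨h1, h2, h3⟩ := hop u huP
      have hstep : G.Step (cfg T) (cfg (insert u T)) 0 := by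
        have := Step.compute (G := G) (cfg T) u p huP
          (by simp only [cfg]; split_ifs <;> simp [h1])
          (by simp [Complete, cfg, h2, h3]) (Or.inr (by simp [cfg])) (by simpa [cfg] using hu)
        convert this using 1
        simp only [cfg, Finset.insert_ne_empty, if_false, Function.update_idem,
          Function.update_self, PebbleConfig.mk.injEq, and_true]
        constructor
        · split_ifs <;> simp
        · simp
      refine Reaches.tail (ih ((Finset.subset_insert u T).trans hT)) hstep ?_
      simp only [cfg, Finset.insert_ne_empty, if_false]
      exact (Finset.card_insert_le _ _).trans (by omega)
  refine ⟨_, 0, le_rfl, key _ subset_rfl, hc.update ?_ ?_⟩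
  · simp [Holds, cfg, hne.ne_empty]
  · intro w hw
    simp [cfg, hne.ne_empty, hw]

/-- No extra pebble is needed: a `ready` value counts as being in fast memory even if it has not
been started. -/
theorem accumulate {u z : V} {X : Finset V} (hS : Fits S M) (hz : S z = ready X)
    (hu : (S u).IsOperand (G.pred u)) (huz : u ∈ G.pred z) (hX : u ∉ X) :
    G.Can M S 0 (Function.update S z (ready (insert u X))) := by
  intro c hc
  have hcu := hc u
  have hcz := hc z
  rw [hz] at hcz
  have hu' : u ∈ c.red ∧ G.Complete c u := by
    rcases hu with h | h <;> rw [h] at hcu <;> simp only [Holds] at hcu <;>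
      simp only [Complete] <;> tauto
  have hsat : Sat (Function.update S z (ready (insert u X)))
      { red := insert z c.red
        blue := c.blue \ {z}
        agg := Function.update c.agg z (insert u (c.agg z)) } := by
    refine hc.update ?_ ?_
    · simp [Holds, hcz.1]
    · intro w hw
      simp [hw]
  refine ⟨_, 0, le_rfl, .single (.compute c u z huz hu'.1 hu'.2 ?_ ?_) ?_, hsat⟩
  · rcases hcz.2 with h | h
    · exact Or.inl h
    · exact Or.inr h.1
  · rw [hcz.1]
    exact hX
  · exact hsat.card_red_le (hS.update_of_inFast (by rw [hz]; trivial) _)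

/-- Compute a product and aggregate it into a sum. -/
theorem mulAccumulate {p z : V} {X : Finset V} (hS : Fits S M) (hp : S p = idle)
    (hne : (G.pred p).Nonempty) (hops : ∀ u ∈ G.pred p, (S u).IsOperand (G.pred u))
    (hz : S z = ready X) (hpz : p ∈ G.pred z) (hX : p ∉ X) :
    G.Can (M + 1) S 0 (Function.update S z (ready (insert p X))) := by
  have hzp : z ≠ p := by
    rintro rfl
    simp [hp] at hz
  have h1 := fresh hS hp hne hops
  have h2 := accumulate (G := G) (u := p) (z := z) (X := X)
    (hS.update p (held (G.pred p))) (by rw [Function.update_of_ne hzp, hz])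
    (Or.inr (by simp)) hpz hX
  have h3 := drop (G := G) (M := M + 1)
    (S := Function.update (Function.update S p (held (G.pred p))) z (ready (insert p X)))
    ((hS.update p _).update_of_inFast (by rw [Function.update_of_ne hzp, hz]; trivial) _) p
  have h := (h1.trans h2).trans h3
  have heq : Function.update (Function.update (Function.update S p (held (G.pred p))) z
      (ready (insert p X))) p idle = Function.update S z (ready (insert p X)) := by
    rw [Function.update_comm hzp, Function.update_idem, ← hp, Function.update_eq_self]
  rwa [heq] at h

theorem save {v : V} {X : Finset V} (hS : Fits S M) (hv : S v = held X) :
    G.Can M S 1 (Function.update S v (cached X)) := by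
  intro c hc
  have hcv := hc v
  rw [hv] at hcv
  refine ⟨_, 1, le_rfl, .single (.save c v hcv.1) (hc.card_red_le hS), hc.update ?_ ?_⟩
  · simp [Holds, hcv.1, hcv.2]
  · intro w hw
    simp [hw]

theorem transfer_one {v : V} {s : PebbleStatus V} (hS : Fits S M)
    (hS' : Fits (Function.update S v s) M) (hv : Transfer (S v) s) :
    G.Can M S 1 (Function.update S v s) := by
  intro c hc
  have hcv := hc v
  have hcard := hc.card_red_le hS
  generalize hs₀ : S v = s₀ at hv hcv
  cases hv with
  | load X =>
    have hsat : Sat (Function.update S v (cached X)) { c with red := insert v c.red } :=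
      hc.update (by simpa [Holds] using hcv.2) fun w hw => by simp [hw]
    exact ⟨_, 1, le_rfl, .single (.load c v hcv.2.1) (hsat.card_red_le hS'), hsat⟩
  | evict X =>
    have hsat : Sat (Function.update S v (stored X)) { c with red := c.red.erase v } :=
      hc.update (by simpa [Holds] using hcv.2) fun w hw => by simp [hw]
    exact ⟨_, 0, Nat.zero_le _, .single (.evict c v hcv.2.1) (hsat.card_red_le hS'), hsat⟩
  | bring X =>
    -- A retired value without a blue pebble has nothing aggregated, hence is `ready` at no cost.
    by_cases hb : v ∈ c.blue
    · have hsat : Sat (Function.update S v (ready X)) { c with red := insert v c.red } :=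
        hc.update (by simpa [Holds] using hcv.2.1) fun w hw => by simp [hw]
      exact ⟨_, 1, le_rfl, .single (.load c v hb) (hsat.card_red_le hS'), hsat⟩
    · refine ⟨c, 0, Nat.zero_le _, .refl c, hc.update ?_ fun w _ => by simp⟩
      refine ⟨hcv.2.1, Or.inr ⟨hb, ?_⟩⟩
      by_contra hX
      exact hb (hcv.2.2 hX)
  | retire X =>
    rcases hcv.2 with hr | ⟨hb, hX⟩
    · have hsat : Sat (Function.update S v (retired X))
          { red := c.red.erase v, blue := insert v c.blue, agg := c.agg } :=
        hc.update (by simpa [Holds] using hcv.1) fun w hw => by simp [hw]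
      refine ⟨_, 1 + 0, le_rfl, (Reaches.single (.save c v hr) hcard).trans
        (.single (.evict _ v (by simp)) (hsat.card_red_le hS')), hsat⟩
    · by_cases hr : v ∈ c.red
      · refine ⟨_, 1 + 0, le_rfl, (Reaches.single (.save c v hr) hcard).trans
          (.single (.evict _ v (by simp))
            ((Finset.card_le_card (Finset.erase_subset _ _)).trans hcard)), ?_⟩
        exact hc.update (by simpa [Holds] using hcv.1) fun w hw => by simp [hw]
      · exact ⟨c, 0, Nat.zero_le _, .refl c,
          hc.update ⟨hr, hcv.1, fun h => absurd hX h⟩ fun w _ => by simp⟩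

/-- Transfer the values of `L` between the memories. -/
theorem transfer (L R : Finset V) (hR : R.card ≤ M) (hS : ∀ v, (S v).InFast → v ∈ R)
    (hS' : ∀ v, (S' v).InFast → v ∈ R) (hL : ∀ v ∈ L, Transfer (S v) (S' v))
    (hout : ∀ v ∉ L, S' v = S v) : G.Can M S L.card S' := by
  -- Every intermediate state mixes `S` and `S'`, so its fast values stay in `R`, whatever the order
  -- of the transfers.
  have hfits : ∀ t : Finset V, Fits (t.piecewise S' S) M := fun t =>
    ⟨R, hR, fun v hv => by
      by_cases hvt : v ∈ t
      · rw [Finset.piecewise_eq_of_mem _ _ _ hvt] at hv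
        exact hS' v hv
      · rw [Finset.piecewise_eq_of_notMem _ _ _ hvt] at hv
        exact hS v hv⟩
  have h := loop (G := G) (M := M) (k := 1) L (fun t => t.piecewise S' S) fun t _ v hv hvt => by
    have heq := Finset.piecewise_insert t S' S v
    rw [heq]
    refine transfer_one (hfits t) (heq ▸ hfits _) ?_
    rw [Finset.piecewise_eq_of_notMem _ _ _ hvt]
    exact hL v hv
  simp only [Finset.piecewise_empty, mul_one] at h
  have hend : L.piecewise S' S = S' := by
    funext v
    by_cases hvL : v ∈ L
    · rw [Finset.piecewise_eq_of_mem _ _ _ hvL]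
    · rw [Finset.piecewise_eq_of_notMem _ _ _ hvL, hout v hvL]
  rwa [hend] at h

end Can

end CompDAG

/-! ## A pebbling of the attention algorithm -/

namespace AttNode

open PebbleStatus CompDAG

variable {n d g : ℕ}

/-- The sum `A i j` or, for the column `none`, the sum `D i`. -/
def acc (i : Fin n) : Option (Fin d) → AttNode n d g
  | none => D i
  | some j => A i j

/-- The entry `H m j` or, for the column `none`, the entry `S m`. -/
def res (m : AttMonomial d g) : Option (Fin d) → AttNode n d g
  | none => S m
  | some j => H m j

/-- The operand with index `m` of `acc i c`. -/
def prod (i : Fin n) (m : AttMonomial d g) : Option (Fin d) → AttNode n d g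
  | none => prodD i m
  | some j => prodA i m j

/-- The operand with index `l` of `res m c`. -/
def term (m : AttMonomial d g) (l : Fin n) : Option (Fin d) → AttNode n d g
  | none => U₂ l m
  | some j => prodH m l j

/-- The entry `V l j` or, for the column `none`, a constant. -/
def valueEntry (l : Fin n) : Option (Fin d) → AttNode n d g
  | none => U₂ l AttMonomial.one
  | some j => V l j

theorem term_injective (m : AttMonomial d g) (c : Option (Fin d)) : Function.Injective
    fun l : Fin n => term m l c := by
  intro l l' h
  rcases c with _ | j <;> simpa [term] using h

theorem prod_injective (i : Fin n) (c : Option (Fin d)) : Function.Injective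
    fun m : AttMonomial d g => prod i m c := by
  intro l l' h
  rcases c with _ | j <;> simpa [prod] using h

theorem operands_U₁ (i : Fin n) (m : AttMonomial d g) :
    operands (U₁ i m) = m.supp.image fun a => Q i a := rfl

theorem operands_U₂ (l : Fin n) (m : AttMonomial d g) :
    operands (U₂ l m) = m.supp.image fun a => K l a := rfl

theorem operands_res (m : AttMonomial d g) (c : Option (Fin d)) :
    operands (res m c : AttNode n d g) = Finset.univ.image fun l => term m l c := by
  rcases c with _ | j <;> rfl

theorem operands_acc (i : Fin n) (c : Option (Fin d)) :
    operands (acc i c : AttNode n d g) = Finset.univ.image fun m => prod i m c := by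
  rcases c with _ | j <;> rfl

theorem operands_prod (i : Fin n) (m : AttMonomial d g) (c : Option (Fin d)) :
    operands (prod i m c : AttNode n d g) = {U₁ i m, res m c} := by
  rcases c with _ | j <;> rfl

/-- A product that is aggregated into `res m c` or `acc i c`: its row, its monomial and its
column. -/
abbrev Triple (n d g : ℕ) : Type := Fin n × AttMonomial d g × Option (Fin d)

/-- The part of the operands of `res m c` with indices in `T`. -/
def termsOf (T : Finset (Triple n d g)) (m : AttMonomial d g) (c : Option (Fin d)) :
    Finset (AttNode n d g) :=
  (Finset.univ.filter fun l => (l, m, c) ∈ T).image fun l => term m l c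

/-- The part of the operands of `acc i c` with indices in `T`. -/
def prodsOf (T : Finset (Triple n d g)) (i : Fin n) (c : Option (Fin d)) :
    Finset (AttNode n d g) :=
  (Finset.univ.filter fun m => (i, m, c) ∈ T).image fun m => prod i m c

section Operands

variable {T : Finset (Triple n d g)} {l i : Fin n} {m m' : AttMonomial d g} {c c' : Option (Fin d)}

theorem termsOf_insert :
    termsOf (insert (l, m, c) T) m c = insert (term m l c) (termsOf T m c) := by
  rw [termsOf, termsOf, ← Finset.image_insert (fun l => term m l c)]
  congr 1
  ext l'
  simp

theorem termsOf_insert_of_ne (h : (m', c') ≠ (m, c)) :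
    termsOf (insert (l, m, c) T) m' c' = termsOf T m' c' := by
  rw [termsOf, termsOf]
  congr 1
  ext l'
  simp only [Finset.mem_filter, Finset.mem_univ, true_and, Finset.mem_insert, Prod.mk.injEq]
  simp only [ne_eq, Prod.mk.injEq] at h
  tauto

theorem term_notMem_termsOf (h : (l, m, c) ∉ T) : term m l c ∉ termsOf T m c := by
  intro hmem
  obtain ⟨l', hl', heq⟩ := Finset.mem_image.1 hmem
  obtain rfl := term_injective m c heq
  exact h (Finset.mem_filter.1 hl').2

theorem termsOf_univ : termsOf (Finset.univ : Finset (Triple n d g)) m c = operands (res m c) := by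
  simp [termsOf, operands_res]

theorem termsOf_empty : termsOf (∅ : Finset (Triple n d g)) m c = ∅ := by
  simp [termsOf]

theorem prodsOf_insert :
    prodsOf (insert (i, m, c) T) i c = insert (prod i m c) (prodsOf T i c) := by
  rw [prodsOf, prodsOf, ← Finset.image_insert (fun m => prod i m c)]
  congr 1
  ext l'
  simp

theorem prodsOf_insert_of_ne {i' : Fin n} (h : (i', c') ≠ (i, c)) :
    prodsOf (insert (i, m, c) T) i' c' = prodsOf T i' c' := by
  rw [prodsOf, prodsOf]
  congr 1
  ext l'
  simp only [Finset.mem_filter, Finset.mem_univ, true_and, Finset.mem_insert, Prod.mk.injEq]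
  simp only [ne_eq, Prod.mk.injEq] at h
  tauto

theorem prod_notMem_prodsOf (h : (i, m, c) ∉ T) : prod i m c ∉ prodsOf T i c := by
  intro hmem
  obtain ⟨l', hl', heq⟩ := Finset.mem_image.1 hmem
  obtain rfl := prod_injective i c heq
  exact h (Finset.mem_filter.1 hl').2

theorem prodsOf_univ : prodsOf (Finset.univ : Finset (Triple n d g)) i c = operands (acc i c) := by
  simp [prodsOf, operands_acc]

theorem prodsOf_empty : prodsOf (∅ : Finset (Triple n d g)) i c = ∅ := by
  simp [prodsOf]

end Operands

/-! ### Computing `H` and `S` -/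

/-- The state of the pebbling while `H` and `S` are computed: the entries with monomials in `κ` and
columns in `J` are being computed, the variables `W` of the row `act` are in fast memory, and the
products with indices in `T` have been aggregated. -/
def keySpec (κ : Finset (AttMonomial d g)) (J : Finset (Option (Fin d))) (W : Finset (Fin d))
    (act : Option (Fin n)) (T : Finset (Triple n d g)) :
    AttNode n d g → PebbleStatus (AttNode n d g)
  | Q _ _ => stored ∅
  | K l a => if act = some l ∧ a ∈ W then cached ∅ else stored ∅
  | V l j => if act = some l ∧ some j ∈ J then cached ∅ else stored ∅
  | U₁ _ m => if m = AttMonomial.one then stored ∅ else idle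
  | U₂ l m => if m = AttMonomial.one then (if act = some l then cached ∅ else stored ∅) else idle
  | H m j => if m ∈ κ ∧ some j ∈ J then ready (termsOf T m (some j))
      else retired (termsOf T m (some j))
  | S m => if m ∈ κ ∧ none ∈ J then ready (termsOf T m none) else retired (termsOf T m none)
  | A _ _ | D _ => retired ∅
  | prodH _ _ _ | prodA _ _ _ | prodD _ _ | out _ _ => idle

section Key

variable {κ : Finset (AttMonomial d g)} {J : Finset (Option (Fin d))} {W : Finset (Fin d)}
  {act : Option (Fin n)} {T : Finset (Triple n d g)} {M : ℕ}

theorem keySpec_res (m : AttMonomial d g) (c : Option (Fin d)) :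
    keySpec κ J W act T (res m c) =
      if m ∈ κ ∧ c ∈ J then ready (termsOf T m c) else retired (termsOf T m c) := by
  rcases c with _ | j <;> rfl

theorem update_keySpec {l : Fin n} {m : AttMonomial d g} {c : Option (Fin d)} (hm : m ∈ κ)
    (hc : c ∈ J) :
    Function.update (keySpec κ J W act T) (res m c)
      (ready (insert (term m l c) (termsOf T m c))) =
        keySpec κ J W act (insert (l, m, c) T) := by
  funext v
  by_cases hv : v = res m c
  · subst hv
    rw [Function.update_self, keySpec_res, if_pos ⟨hm, hc⟩, termsOf_insert]
  · rw [Function.update_of_ne hv]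
    have key : ∀ m' c', v = res m' c' → (m', c') ≠ (m, c) := by
      rintro m' c' rfl h
      rw [Prod.mk.injEq] at h
      exact hv (by rw [h.1, h.2])
    cases v with
    | H m' j => simp only [keySpec, termsOf_insert_of_ne (key m' (some j) rfl)]
    | S m' => simp only [keySpec, termsOf_insert_of_ne (key m' none rfl)]
    | _ => rfl

/-- The inputs that are in fast memory while the row `l` is processed. -/
def keyInputs (J : Finset (Option (Fin d))) (W : Finset (Fin d)) (l : Fin n) :
    Finset (AttNode n d g) :=
  W.image (K l) ∪ J.image (valueEntry l) ∪ {U₂ l AttMonomial.one}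

/-- The values that are in fast memory while the row `l` is processed. -/
def keyWorkspace (κ : Finset (AttMonomial d g)) (J : Finset (Option (Fin d)))
    (W : Finset (Fin d)) (l : Fin n) : Finset (AttNode n d g) :=
  (κ ×ˢ J).image (fun p => res p.1 p.2) ∪ keyInputs J W l

theorem card_keyInputs_le (J : Finset (Option (Fin d))) (W : Finset (Fin d)) (l : Fin n) :
    (keyInputs J W l : Finset (AttNode n d g)).card ≤ W.card + J.card + 1 := by
  refine (Finset.card_union_le _ _).trans (add_le_add ?_ (by simp))
  exact (Finset.card_union_le _ _).trans (add_le_add Finset.card_image_le Finset.card_image_le)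

theorem card_keyWorkspace_le (l : Fin n) :
    (keyWorkspace κ J W l).card ≤ κ.card * J.card + (W.card + J.card + 1) := by
  refine (Finset.card_union_le _ _).trans (add_le_add ?_ (card_keyInputs_le J W l))
  rw [← Finset.card_product]
  exact Finset.card_image_le

theorem mem_keyWorkspace {l : Fin n} (hact : ∀ l', act = some l' → l' = l) {v : AttNode n d g}
    (hv : (keySpec κ J W act T v).InFast) : v ∈ keyWorkspace κ J W l := by
  simp only [keyWorkspace, keyInputs, Finset.mem_union, Finset.mem_image, Finset.mem_product,
    Finset.mem_singleton, Prod.exists]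
  cases v with
  | K l' a =>
    simp only [keySpec] at hv
    split_ifs at hv with h
    · exact Or.inr (Or.inl (Or.inl ⟨a, h.2, by rw [hact _ h.1]⟩))
    · exact hv.elim
  | V l' j =>
    simp only [keySpec] at hv
    split_ifs at hv with h
    · exact Or.inr (Or.inl (Or.inr ⟨some j, h.2, by rw [hact _ h.1]; rfl⟩))
    · exact hv.elim
  | U₁ i m =>
    simp only [keySpec] at hv
    split_ifs at hv <;> exact hv.elim
  | U₂ l' m =>
    simp only [keySpec] at hv
    split_ifs at hv with h h'
    · exact Or.inr (Or.inr (by rw [h, hact _ h']))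
    · exact hv.elim
    · exact hv.elim
  | H m j =>
    simp only [keySpec] at hv
    split_ifs at hv with h
    · exact Or.inl ⟨m, some j, h, rfl⟩
    · exact hv.elim
  | S m =>
    simp only [keySpec] at hv
    split_ifs at hv with h
    · exact Or.inl ⟨m, none, h, rfl⟩
    · exact hv.elim
  | _ => exact hv.elim

/-- The column `none` sums the entries of `U₂` directly; the other columns need a product with an
entry of `V` first. -/
theorem can_addTerm {Sp : AttNode n d g → PebbleStatus (AttNode n d g)} (hS : Fits Sp M)
    {l : Fin n} {m : AttMonomial d g} {c : Option (Fin d)} {X : Finset (AttNode n d g)}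
    (hU : (Sp (U₂ l m)).IsOperand (operands (U₂ l m)))
    (hV : ∀ j, c = some j → (Sp (V l j)).IsOperand ∅)
    (hp : ∀ j, c = some j → Sp (prodH m l j) = idle) (hz : Sp (res m c) = ready X)
    (hX : term m l c ∉ X) :
    (attentionDAG n d g).Can (M + 1) Sp 0
      (Function.update Sp (res m c) (ready (insert (term m l c) X))) := by
  rcases c with _ | j
  · exact Can.accumulate (hS.mono (Nat.le_succ M)) hz hU
      (Finset.mem_image_of_mem _ (Finset.mem_univ l)) hX
  · refine Can.mulAccumulate hS (hp j rfl) ⟨U₂ l m, by simp [attentionDAG, operands, term]⟩ ?_ hz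
      (Finset.mem_image_of_mem _ (Finset.mem_univ l)) hX
    intro u hu
    have hu' : u = U₂ l m ∨ u = V l j := by simpa [attentionDAG, operands, term] using hu
    rcases hu' with rfl | rfl
    · exact hU
    · exact hV j rfl

/-- The entry of `U₂` is recomputed from variables in fast memory, used for all columns of `J` and
dropped, all without I/O. The two pebbles beyond `M` hold this entry and the current product. -/
theorem can_key_entry {l : Fin n}
    (hfit : ∀ T : Finset (Triple n d g), Fits (keySpec κ J W (some l) T) M)
    {m : AttMonomial d g} (hm : m ∈ κ) (hmW : m.supp ⊆ W) (hT : ∀ c ∈ J, (l, m, c) ∉ T) :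
    (attentionDAG n d g).Can (M + 2) (keySpec κ J W (some l) T) 0
      (keySpec κ J W (some l) (T ∪ J.image fun c => (l, m, c))) := by
  -- The constant entry is a source: it was loaded with the row and must be neither computed nor
  -- dropped.
  set σ : PebbleStatus (AttNode n d g) :=
    if m = AttMonomial.one then cached ∅ else held (operands (U₂ l m)) with hσ
  have hσop : σ.IsOperand (operands (U₂ l m)) := by
    by_cases h1 : m = AttMonomial.one
    · left
      rw [hσ, if_pos h1, operands_U₂, AttMonomial.supp_eq_empty.2 h1, Finset.image_empty]
    · right
      rw [hσ, if_neg h1]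
  have hone : ∀ T' : Finset (Triple n d g), m = AttMonomial.one →
      Function.update (keySpec κ J W (some l) T') (U₂ l m) σ = keySpec κ J W (some l) T' := by
    intro T' h1
    rw [Function.update_eq_self_iff]
    simp [hσ, keySpec, h1]
  have hstart : (attentionDAG n d g).Can (M + 2) (keySpec κ J W (some l) T) 0
      (Function.update (keySpec κ J W (some l) T) (U₂ l m) σ) := by
    by_cases h1 : m = AttMonomial.one
    · rw [hone T h1]
      exact Can.refl _
    · rw [hσ, if_neg h1]
      refine Can.fresh ((hfit T).mono (Nat.le_succ M)) (by simp [keySpec, h1]) ?_ ?_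
      · change (operands (U₂ l m)).Nonempty
        rw [operands_U₂, Finset.image_nonempty, Finset.nonempty_iff_ne_empty]
        exact fun h => h1 (AttMonomial.supp_eq_empty.1 h)
      · intro u hu
        obtain ⟨a, ha, rfl⟩ := Finset.mem_image.1 hu
        left
        simp [keySpec, attentionDAG, operands, hmW ha]
  have hend : ∀ T' : Finset (Triple n d g), (attentionDAG n d g).Can (M + 2)
      (Function.update (keySpec κ J W (some l) T') (U₂ l m) σ) 0 (keySpec κ J W (some l) T') := by
    intro T'
    by_cases h1 : m = AttMonomial.one
    · rw [hone T' h1]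
      exact Can.refl _
    · have h := Can.drop (G := attentionDAG n d g) (((hfit T').update (U₂ l m) σ).mono
        (Nat.le_succ (M + 1))) (U₂ l m)
      rwa [Function.update_idem, show (idle : PebbleStatus (AttNode n d g)) =
        keySpec κ J W (some l) T' (U₂ l m) by simp [keySpec, h1], Function.update_eq_self] at h
  have hloop := Can.loop (G := attentionDAG n d g) (M := M + 2) (k := 0) J
    (fun t => Function.update (keySpec κ J W (some l) (T ∪ t.image fun c => (l, m, c)))
      (U₂ l m) σ) fun t _ c hc hct => by
    have hcT : (l, m, c) ∉ T ∪ t.image fun c => (l, m, c) := by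
      simp [hT c hc, hct]
    have hne : (res m c : AttNode n d g) ≠ U₂ l m := by rcases c with _ | j <;> simp [res]
    have h := can_addTerm (n := n) (M := M + 1)
      (Sp := Function.update (keySpec κ J W (some l) (T ∪ t.image fun c => (l, m, c))) (U₂ l m) σ)
      ((hfit _).update _ _) (l := l) (m := m) (c := c) (by simpa using hσop)
      (fun j hj => by
        left
        rw [Function.update_of_ne (by simp)]
        simp [keySpec, ← hj, hc])
      (fun j hj => by
        rw [Function.update_of_ne (by simp)]
        simp [keySpec])
      (by rw [Function.update_of_ne hne, keySpec_res, if_pos ⟨hm, hc⟩])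
      (term_notMem_termsOf hcT)
    rw [Function.update_comm hne.symm, update_keySpec hm hc, ← Finset.union_insert,
      ← Finset.image_insert (fun c => (l, m, c))] at h
    exact h
  simp only [Finset.image_empty, Finset.union_empty, mul_zero] at hloop
  exact (hstart.trans hloop).trans (hend _)

theorem keySpec_of_notMem_keyInputs {l : Fin n} {v : AttNode n d g} (hv : v ∉ keyInputs J W l) :
    keySpec κ J W (some l) T v = keySpec κ J W none T v := by
  simp only [keyInputs, Finset.mem_union, Finset.mem_image, Finset.mem_singleton, not_or,
    not_exists, not_and] at hv
  cases v with
  | K l' a =>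
    have := hv.1.1 a
    simp only [keySpec, Option.some.injEq, reduceCtorEq, false_and, if_false]
    refine if_neg ?_
    rintro ⟨rfl, ha⟩
    exact this ha rfl
  | V l' j =>
    have := hv.1.2 (some j)
    simp only [keySpec, Option.some.injEq, reduceCtorEq, false_and, if_false]
    refine if_neg ?_
    rintro ⟨rfl, ha⟩
    exact this ha rfl
  | U₂ l' m =>
    have := hv.2
    simp only [keySpec, Option.some.injEq, reduceCtorEq, if_false]
    by_cases hm : m = AttMonomial.one
    · subst hm
      have hll : ¬ l = l' := fun h => this (by rw [h])
      simp [hll]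
    · simp [hm]
  | _ => rfl

theorem keySpec_of_mem_keyInputs {l : Fin n} {v : AttNode n d g} (hv : v ∈ keyInputs J W l) :
    keySpec κ J W (some l) T v = cached ∅ ∧ keySpec κ J W none T v = stored ∅ := by
  simp only [keyInputs, Finset.mem_union, Finset.mem_image, Finset.mem_singleton] at hv
  rcases hv with (⟨a, ha, rfl⟩ | ⟨c, hc, rfl⟩) | rfl
  · simp [keySpec, ha]
  · rcases c with _ | j
    · simp [keySpec, valueEntry]
    · simp [keySpec, valueEntry, hc]
  · simp [keySpec]

/-- The factor `2` arises because `Can.transfer` charges one unit also for evicting an input. -/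
theorem can_key_row {l : Fin n} (hM : κ.card * J.card + (W.card + J.card + 1) ≤ M)
    (hW : ∀ m ∈ κ, m.supp ⊆ W) (hT : ∀ m ∈ κ, ∀ c ∈ J, (l, m, c) ∉ T) :
    (attentionDAG n d g).Can (M + 2) (keySpec κ J W none T) (2 * (W.card + J.card + 1))
      (keySpec κ J W none (T ∪ {l} ×ˢ κ ×ˢ J)) := by
  have hcard : (keyWorkspace κ J W l).card ≤ M := (card_keyWorkspace_le l).trans hM
  have hfit : ∀ T : Finset (Triple n d g), Fits (keySpec κ J W (some l) T) M := fun T =>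
    ⟨_, hcard, fun v hv => mem_keyWorkspace (by simp) hv⟩
  have hloop := Can.loop (G := attentionDAG n d g) (M := M + 2) (k := 0) κ
    (fun t => keySpec κ J W (some l) (T ∪ {l} ×ˢ t ×ˢ J)) fun t _ m hm hmt => by
    have h := can_key_entry (T := T ∪ {l} ×ˢ t ×ˢ J) hfit hm (hW m hm)
      (fun c hc => by simp [hT m hm c hc, hmt])
    have heq : (T ∪ {l} ×ˢ t ×ˢ J) ∪ (J.image fun c => (l, m, c)) =
        T ∪ {l} ×ˢ (insert m t) ×ˢ J := by
      ext ⟨l', m', c'⟩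
      simp only [Finset.mem_union, Finset.mem_product, Finset.mem_singleton, Finset.mem_image,
        Finset.mem_insert, Prod.mk.injEq]
      constructor
      · rintro ((h | h) | ⟨c, hc, rfl, rfl, rfl⟩) <;> tauto
      · rintro (h | ⟨rfl, rfl | h, h'⟩) <;> tauto
    rwa [heq] at h
  simp only [Finset.empty_product, Finset.product_empty, Finset.union_empty, mul_zero] at hloop
  have hcard' : (keyWorkspace κ J W l).card ≤ M + 2 := by omega
  have h1 := Can.transfer (G := attentionDAG n d g) (M := M + 2) (S := keySpec κ J W none T)
    (S' := keySpec κ J W (some l) T) (keyInputs J W l) (keyWorkspace κ J W l) hcard'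
    (fun v hv => mem_keyWorkspace (by simp) hv) (fun v hv => mem_keyWorkspace (by simp) hv)
    (fun v hv => by
      rw [(keySpec_of_mem_keyInputs hv).1, (keySpec_of_mem_keyInputs hv).2]
      exact .load ∅) (fun v hv => keySpec_of_notMem_keyInputs hv)
  have h2 := fun T : Finset (Triple n d g) => Can.transfer (G := attentionDAG n d g) (M := M + 2)
    (S := keySpec κ J W (some l) T) (S' := keySpec κ J W none T) (keyInputs J W l)
    (keyWorkspace κ J W l) hcard'
    (fun v hv => mem_keyWorkspace (by simp) hv) (fun v hv => mem_keyWorkspace (by simp) hv)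
    (fun v hv => by
      rw [(keySpec_of_mem_keyInputs hv).1, (keySpec_of_mem_keyInputs hv).2]
      exact .evict ∅) (fun v hv => (keySpec_of_notMem_keyInputs hv).symm)
  have := card_keyInputs_le (g := g) J W l
  exact ((h1.trans hloop).trans (h2 _)).mono (by omega)

/-- The partial sums for `κ` and `J` stay in fast memory while all rows are streamed; they are moved
in and out once. -/
theorem can_key_block (hn : 1 ≤ n) (hM : κ.card * J.card + (W.card + J.card + 1) ≤ M)
    (hW : ∀ m ∈ κ, m.supp ⊆ W) (hT : ∀ l, ∀ m ∈ κ, ∀ c ∈ J, (l, m, c) ∉ T) :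
    (attentionDAG n d g).Can (M + 2) (keySpec ∅ ∅ ∅ none T)
      (2 * (κ.card * J.card) + n * (2 * (W.card + J.card + 1)))
      (keySpec ∅ ∅ ∅ none (T ∪ Finset.univ ×ˢ κ ×ˢ J)) := by
  have hcard : (keyWorkspace κ J W (⟨0, hn⟩ : Fin n)).card ≤ M + 2 :=
    (card_keyWorkspace_le _).trans (by omega)
  have hempty : ∀ (T : Finset (Triple n d g)) v,
      ¬ (keySpec (n := n) (∅ : Finset (AttMonomial d g)) ∅ ∅ none T v).InFast := by
    intro T v
    cases v with
    | U₁ i m => by_cases h : m = AttMonomial.one <;> simp [keySpec, InFast, h]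
    | U₂ i m => by_cases h : m = AttMonomial.one <;> simp [keySpec, InFast, h]
    | _ => simp [keySpec, InFast]
  have hout : ∀ (T : Finset (Triple n d g)), ∀ v ∉ (κ ×ˢ J).image (fun p => res p.1 p.2),
      keySpec κ J W none T v = keySpec ∅ ∅ ∅ none T v := by
    intro T v hv
    simp only [Finset.mem_image, Finset.mem_product, not_exists, not_and, Prod.forall] at hv
    cases v with
    | H m j =>
      have := hv m (some j)
      simp only [keySpec, Finset.notMem_empty, false_and, if_false]
      exact if_neg fun h => this h rfl
    | S m =>
      have := hv m none
      simp only [keySpec, Finset.notMem_empty, false_and, if_false]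
      exact if_neg fun h => this h rfl
    | _ => simp [keySpec]
  have hrow := Can.loop (G := attentionDAG n d g) (M := M + 2) (k := 2 * (W.card + J.card + 1))
    (Finset.univ : Finset (Fin n)) (fun t => keySpec κ J W none (T ∪ t ×ˢ κ ×ˢ J))
    fun t _ l _ hlt => by
    have h := can_key_row (T := T ∪ t ×ˢ κ ×ˢ J) (l := l) hM hW
      (fun m hm c hc => by simp [hT l m hm c hc, hlt])
    have heq : (T ∪ t ×ˢ κ ×ˢ J) ∪ {l} ×ˢ κ ×ˢ J = T ∪ (insert l t) ×ˢ κ ×ˢ J := by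
      ext ⟨l', m', c'⟩
      simp only [Finset.mem_union, Finset.mem_product, Finset.mem_singleton, Finset.mem_insert]
      tauto
    rwa [heq] at h
  simp only [Finset.empty_product, Finset.union_empty, Finset.card_univ,
    Fintype.card_fin] at hrow
  have h1 := Can.transfer (G := attentionDAG n d g) (M := M + 2) (S := keySpec ∅ ∅ ∅ none T)
    (S' := keySpec κ J W none T) ((κ ×ˢ J).image (fun p => res p.1 p.2))
    (keyWorkspace κ J W ⟨0, hn⟩) hcard
    (fun v hv => absurd hv (hempty T v)) (fun v hv => mem_keyWorkspace (by simp) hv)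
    (fun v hv => by
      obtain ⟨⟨m, c⟩, hp, rfl⟩ := Finset.mem_image.1 hv
      rw [keySpec_res, keySpec_res, if_pos (Finset.mem_product.1 hp), if_neg (by simp)]
      exact .bring _) (hout T)
  have h2 := fun T : Finset (Triple n d g) => Can.transfer (G := attentionDAG n d g) (M := M + 2)
    (S := keySpec κ J W none T) (S' := keySpec ∅ ∅ ∅ none T)
    ((κ ×ˢ J).image (fun p => res p.1 p.2))
    (keyWorkspace κ J W ⟨0, hn⟩) hcard (fun v hv => mem_keyWorkspace (by simp) hv)
    (fun v hv => absurd hv (hempty _ v))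
    (fun v hv => by
      obtain ⟨⟨m, c⟩, hp, rfl⟩ := Finset.mem_image.1 hv
      rw [keySpec_res, keySpec_res, if_pos (Finset.mem_product.1 hp), if_neg (by simp)]
      exact .retire _) (fun v hv => (hout _ v hv).symm)
  have : ((κ ×ˢ J).image (fun p => (res p.1 p.2 : AttNode n d g))).card ≤ κ.card * J.card := by
    rw [← Finset.card_product]
    exact Finset.card_image_le
  exact ((h1.trans hrow).trans (h2 _)).mono (by omega)

end Key

end AttNode

namespace AttNode

open PebbleStatus CompDAG

variable {n d g : ℕ}

/-- The pairs of a class and a block partition all monomials and columns, so each product is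
aggregated exactly once. -/
theorem can_keys {α β : Type} [Fintype α] [DecidableEq α] [Fintype β] [DecidableEq β]
    {M F t w : ℕ} (hn : 1 ≤ n) (cls : AttMonomial d g → α) (blk : Option (Fin d) → β)
    (W : α → Finset (Fin d)) (hW : ∀ m, m.supp ⊆ W (cls m)) (hw : ∀ a, (W a).card ≤ w)
    (hF : ∀ a, (Finset.univ.filter fun m => cls m = a).card ≤ F)
    (ht : ∀ b, (Finset.univ.filter fun c => blk c = b).card ≤ t)
    (hM : F * t + (w + t + 1) ≤ M) :
    (attentionDAG n d g).Can (M + 2) (keySpec ∅ ∅ ∅ none ∅)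
      (Fintype.card α * Fintype.card β * (2 * (F * t) + n * (2 * (w + t + 1))))
      (keySpec ∅ ∅ ∅ none Finset.univ) := by
  have hloop := Can.loop (G := attentionDAG n d g) (M := M + 2)
    (k := 2 * (F * t) + n * (2 * (w + t + 1))) (Finset.univ : Finset (α × β))
    (fun P => keySpec ∅ ∅ ∅ none
      (Finset.univ.filter fun e : Triple n d g => (cls e.2.1, blk e.2.2) ∈ P))
    fun P _ ab _ hab => by
      obtain ⟨a, b⟩ := ab
      have hprod : (Finset.univ.filter fun m => cls m = a).card *
          (Finset.univ.filter fun c => blk c = b).card ≤ F * t := Nat.mul_le_mul (hF a) (ht b)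
      have hwa := hw a
      have htb := ht b
      have h := can_key_block (M := M) (κ := Finset.univ.filter fun m => cls m = a)
        (J := Finset.univ.filter fun c => blk c = b) (W := W a)
        (T := Finset.univ.filter fun e : Triple n d g => (cls e.2.1, blk e.2.2) ∈ P) hn (by omega)
        (fun m hm => (Finset.mem_filter.1 hm).2 ▸ hW m)
        (fun l m hm c hc hmem => by
          rw [Finset.mem_filter] at hm hc hmem
          exact hab (by simpa [hm.2, hc.2] using hmem.2))
      have heq : ((Finset.univ.filter fun e : Triple n d g => (cls e.2.1, blk e.2.2) ∈ P) ∪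
          Finset.univ ×ˢ (Finset.univ.filter fun m => cls m = a) ×ˢ
            (Finset.univ.filter fun c => blk c = b)) =
          Finset.univ.filter fun e : Triple n d g => (cls e.2.1, blk e.2.2) ∈ insert (a, b) P := by
        ext ⟨l, m, c⟩
        simp [or_comm]
      rw [heq] at h
      refine h.mono (add_le_add (by omega) (Nat.mul_le_mul_left _ (by omega)))
  simpa using hloop

/-! ### Computing `U₁ H` and `D` -/

/-- The state of the pebbling while `U₁ H` and `D` are computed: the entries of `H` and `S` with
monomials in `κ` and columns in `J` are in fast memory, as well as the variables `W` of the row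
`act`, and the products with indices in `T` have been aggregated. -/
def querySpec (κ : Finset (AttMonomial d g)) (J : Finset (Option (Fin d))) (W : Finset (Fin d))
    (act : Option (Fin n)) (T : Finset (Triple n d g)) :
    AttNode n d g → PebbleStatus (AttNode n d g)
  | Q i a => if act = some i ∧ a ∈ W then cached ∅ else stored ∅
  | K _ _ | V _ _ => stored ∅
  | U₁ i m => if m = AttMonomial.one then (if act = some i then cached ∅ else stored ∅) else idle
  | H m j => if m ∈ κ ∧ some j ∈ J then cached (operands (H m j)) else stored (operands (H m j))
  | S m => if m ∈ κ ∧ none ∈ J then cached (operands (S m)) else stored (operands (S m))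
  | A i j => if act = some i ∧ some j ∈ J then ready (prodsOf T i (some j))
      else retired (prodsOf T i (some j))
  | D i => if act = some i ∧ none ∈ J then ready (prodsOf T i none)
      else retired (prodsOf T i none)
  | U₂ _ _ | prodH _ _ _ | prodA _ _ _ | prodD _ _ | out _ _ => idle

section Query

variable {κ : Finset (AttMonomial d g)} {J : Finset (Option (Fin d))} {W : Finset (Fin d)}
  {act : Option (Fin n)} {T : Finset (Triple n d g)} {M : ℕ}

theorem querySpec_res (m : AttMonomial d g) (c : Option (Fin d)) :
    querySpec κ J W act T (res m c) =
      if m ∈ κ ∧ c ∈ J then cached (operands (res m c)) else stored (operands (res m c)) := by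
  rcases c with _ | j <;> rfl

theorem querySpec_acc (i : Fin n) (c : Option (Fin d)) :
    querySpec κ J W act T (acc i c) =
      if act = some i ∧ c ∈ J then ready (prodsOf T i c) else retired (prodsOf T i c) := by
  rcases c with _ | j <;> rfl

theorem querySpec_prod (i : Fin n) (m : AttMonomial d g) (c : Option (Fin d)) :
    querySpec κ J W act T (prod i m c) = idle := by
  rcases c with _ | j <;> rfl

theorem update_querySpec {i : Fin n} {m : AttMonomial d g} {c : Option (Fin d)} (hc : c ∈ J) :
    Function.update (querySpec κ J W (some i) T) (acc i c)
      (ready (insert (prod i m c) (prodsOf T i c))) =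
        querySpec κ J W (some i) (insert (i, m, c) T) := by
  funext v
  by_cases hv : v = acc i c
  · subst hv
    rw [Function.update_self, querySpec_acc, if_pos ⟨rfl, hc⟩, prodsOf_insert]
  · rw [Function.update_of_ne hv]
    have key : ∀ i' c', v = acc i' c' → (i', c') ≠ (i, c) := by
      rintro i' c' rfl h
      rw [Prod.mk.injEq] at h
      exact hv (by rw [h.1, h.2])
    cases v with
    | A i' j => simp only [querySpec, prodsOf_insert_of_ne (key i' (some j) rfl)]
    | D i' => simp only [querySpec, prodsOf_insert_of_ne (key i' none rfl)]
    | _ => rfl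

/-- The values other than those of `H` and `S` that are in fast memory while the row `i` is
processed. -/
def queryInputs (J : Finset (Option (Fin d))) (W : Finset (Fin d)) (i : Fin n) :
    Finset (AttNode n d g) :=
  W.image (Q i) ∪ J.image (acc i) ∪ {U₁ i AttMonomial.one}

/-- The values that are in fast memory while the row `i` is processed. -/
def queryWorkspace (κ : Finset (AttMonomial d g)) (J : Finset (Option (Fin d)))
    (W : Finset (Fin d)) (i : Fin n) : Finset (AttNode n d g) :=
  (κ ×ˢ J).image (fun p => res p.1 p.2) ∪ queryInputs J W i

theorem card_queryInputs_le (J : Finset (Option (Fin d))) (W : Finset (Fin d)) (i : Fin n) :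
    (queryInputs J W i : Finset (AttNode n d g)).card ≤ W.card + J.card + 1 := by
  refine (Finset.card_union_le _ _).trans (add_le_add ?_ (by simp))
  exact (Finset.card_union_le _ _).trans (add_le_add Finset.card_image_le Finset.card_image_le)

theorem card_queryWorkspace_le (i : Fin n) :
    (queryWorkspace κ J W i).card ≤ κ.card * J.card + (W.card + J.card + 1) := by
  refine (Finset.card_union_le _ _).trans (add_le_add ?_ (card_queryInputs_le J W i))
  rw [← Finset.card_product]
  exact Finset.card_image_le

theorem mem_queryWorkspace {i : Fin n} (hact : ∀ i', act = some i' → i' = i) {v : AttNode n d g}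
    (hv : (querySpec κ J W act T v).InFast) : v ∈ queryWorkspace κ J W i := by
  simp only [queryWorkspace, queryInputs, Finset.mem_union, Finset.mem_image, Finset.mem_product,
    Finset.mem_singleton, Prod.exists]
  cases v with
  | Q i' a =>
    simp only [querySpec] at hv
    split_ifs at hv with h
    · exact Or.inr (Or.inl (Or.inl ⟨a, h.2, by rw [hact _ h.1]⟩))
    · exact hv.elim
  | U₁ i' m =>
    simp only [querySpec] at hv
    split_ifs at hv with h h'
    · exact Or.inr (Or.inr (by rw [h, hact _ h']))
    · exact hv.elim
    · exact hv.elim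
  | H m j =>
    simp only [querySpec] at hv
    split_ifs at hv with h
    · exact Or.inl ⟨m, some j, h, rfl⟩
    · exact hv.elim
  | S m =>
    simp only [querySpec] at hv
    split_ifs at hv with h
    · exact Or.inl ⟨m, none, h, rfl⟩
    · exact hv.elim
  | A i' j =>
    simp only [querySpec] at hv
    split_ifs at hv with h
    · exact Or.inr (Or.inl (Or.inr ⟨some j, h.2, by rw [hact _ h.1]; rfl⟩))
    · exact hv.elim
  | D i' =>
    simp only [querySpec] at hv
    split_ifs at hv with h
    · exact Or.inr (Or.inl (Or.inr ⟨none, h.2, by rw [hact _ h.1]; rfl⟩))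
    · exact hv.elim
  | _ => exact hv.elim

theorem can_query_entry {i : Fin n}
    (hfit : ∀ T : Finset (Triple n d g), Fits (querySpec κ J W (some i) T) M)
    {m : AttMonomial d g} (hm : m ∈ κ) (hmW : m.supp ⊆ W) (hT : ∀ c ∈ J, (i, m, c) ∉ T) :
    (attentionDAG n d g).Can (M + 2) (querySpec κ J W (some i) T) 0
      (querySpec κ J W (some i) (T ∪ J.image fun c => (i, m, c))) := by
  set σ : PebbleStatus (AttNode n d g) :=
    if m = AttMonomial.one then cached ∅ else held (operands (U₁ i m)) with hσ
  have hσop : σ.IsOperand (operands (U₁ i m)) := by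
    by_cases h1 : m = AttMonomial.one
    · left
      rw [hσ, if_pos h1, operands_U₁, AttMonomial.supp_eq_empty.2 h1, Finset.image_empty]
    · right
      rw [hσ, if_neg h1]
  have hone : ∀ T' : Finset (Triple n d g), m = AttMonomial.one →
      Function.update (querySpec κ J W (some i) T') (U₁ i m) σ =
        querySpec κ J W (some i) T' := by
    intro T' h1
    rw [Function.update_eq_self_iff]
    simp [hσ, querySpec, h1]
  have hstart : (attentionDAG n d g).Can (M + 2) (querySpec κ J W (some i) T) 0
      (Function.update (querySpec κ J W (some i) T) (U₁ i m) σ) := by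
    by_cases h1 : m = AttMonomial.one
    · rw [hone T h1]
      exact Can.refl _
    · rw [hσ, if_neg h1]
      refine Can.fresh ((hfit T).mono (Nat.le_succ M)) (by simp [querySpec, h1]) ?_ ?_
      · change (operands (U₁ i m)).Nonempty
        rw [operands_U₁, Finset.image_nonempty, Finset.nonempty_iff_ne_empty]
        exact fun h => h1 (AttMonomial.supp_eq_empty.1 h)
      · intro u hu
        obtain ⟨a, ha, rfl⟩ := Finset.mem_image.1 hu
        left
        simp [querySpec, attentionDAG, operands, hmW ha]
  have hend : ∀ T' : Finset (Triple n d g), (attentionDAG n d g).Can (M + 2)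
      (Function.update (querySpec κ J W (some i) T') (U₁ i m) σ) 0
      (querySpec κ J W (some i) T') := by
    intro T'
    by_cases h1 : m = AttMonomial.one
    · rw [hone T' h1]
      exact Can.refl _
    · have h := Can.drop (G := attentionDAG n d g) (((hfit T').update (U₁ i m) σ).mono
        (Nat.le_succ (M + 1))) (U₁ i m)
      rwa [Function.update_idem, show (idle : PebbleStatus (AttNode n d g)) =
        querySpec κ J W (some i) T' (U₁ i m) by simp [querySpec, h1],
        Function.update_eq_self] at h
  have hloop := Can.loop (G := attentionDAG n d g) (M := M + 2) (k := 0) J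
    (fun t => Function.update (querySpec κ J W (some i) (T ∪ t.image fun c => (i, m, c)))
      (U₁ i m) σ) fun t _ c hc hct => by
    have hcT : (i, m, c) ∉ T ∪ t.image fun c => (i, m, c) := by
      simp [hT c hc, hct]
    have hne : (acc i c : AttNode n d g) ≠ U₁ i m := by rcases c with _ | j <;> simp [acc]
    have hne' : (res m c : AttNode n d g) ≠ U₁ i m := by rcases c with _ | j <;> simp [res]
    have hne'' : (prod i m c : AttNode n d g) ≠ U₁ i m := by rcases c with _ | j <;> simp [prod]
    have h := Can.mulAccumulate (G := attentionDAG n d g) (M := M + 1)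
      (S := Function.update (querySpec κ J W (some i) (T ∪ t.image fun c => (i, m, c)))
        (U₁ i m) σ) (p := prod i m c) (z := acc i c)
      ((hfit _).update _ _) (by rw [Function.update_of_ne hne'', querySpec_prod])
      (by
        change (operands (prod i m c)).Nonempty
        rw [operands_prod]
        exact ⟨_, Finset.mem_insert_self _ _⟩)
      (fun u hu => by
        change u ∈ operands (prod i m c) at hu
        rw [operands_prod, Finset.mem_insert, Finset.mem_singleton] at hu
        rcases hu with rfl | rfl
        · rw [Function.update_self]
          exact hσop
        · left
          rw [Function.update_of_ne hne', querySpec_res, if_pos ⟨hm, hc⟩]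
          rfl)
      (by rw [Function.update_of_ne hne, querySpec_acc, if_pos ⟨rfl, hc⟩])
      (by
        change prod i m c ∈ operands (acc i c)
        rw [operands_acc]
        exact Finset.mem_image_of_mem _ (Finset.mem_univ m))
      (prod_notMem_prodsOf hcT)
    rw [Function.update_comm hne.symm, update_querySpec hc, ← Finset.union_insert,
      ← Finset.image_insert (fun c => (i, m, c))] at h
    exact h
  simp only [Finset.image_empty, Finset.union_empty, mul_zero] at hloop
  exact (hstart.trans hloop).trans (hend _)

theorem querySpec_of_notMem_queryInputs {i : Fin n} {v : AttNode n d g}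
    (hv : v ∉ queryInputs J W i) :
    querySpec κ J W (some i) T v = querySpec κ J W none T v := by
  simp only [queryInputs, Finset.mem_union, Finset.mem_image, Finset.mem_singleton, not_or,
    not_exists, not_and] at hv
  cases v with
  | Q i' a =>
    have := hv.1.1 a
    simp only [querySpec, Option.some.injEq, reduceCtorEq, false_and, if_false]
    refine if_neg ?_
    rintro ⟨rfl, ha⟩
    exact this ha rfl
  | A i' j =>
    have := hv.1.2 (some j)
    simp only [querySpec, Option.some.injEq, reduceCtorEq, false_and, if_false]
    refine if_neg ?_
    rintro ⟨rfl, ha⟩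
    exact this ha rfl
  | D i' =>
    have := hv.1.2 none
    simp only [querySpec, Option.some.injEq, reduceCtorEq, false_and, if_false]
    refine if_neg ?_
    rintro ⟨rfl, ha⟩
    exact this ha rfl
  | U₁ i' m =>
    have := hv.2
    simp only [querySpec, Option.some.injEq, reduceCtorEq, if_false]
    by_cases hm : m = AttMonomial.one
    · subst hm
      have hii : ¬ i = i' := fun h => this (by rw [h])
      simp [hii]
    · simp [hm]
  | _ => rfl

theorem transfer_querySpec {i : Fin n} {v : AttNode n d g} (hv : v ∈ queryInputs J W i) :
    Transfer (querySpec κ J W (some i) T v) (querySpec κ J W none T v) ∧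
      Transfer (querySpec κ J W none T v) (querySpec κ J W (some i) T v) := by
  simp only [queryInputs, Finset.mem_union, Finset.mem_image, Finset.mem_singleton] at hv
  rcases hv with (⟨a, ha, rfl⟩ | ⟨c, hc, rfl⟩) | rfl
  · simp only [querySpec, ha, and_self, if_true, reduceCtorEq, false_and, if_false]
    exact ⟨.evict _, .load _⟩
  · rw [querySpec_acc, querySpec_acc, if_pos ⟨rfl, hc⟩, if_neg (by simp)]
    exact ⟨.retire _, .bring _⟩
  · simp only [querySpec, if_true, reduceCtorEq, if_false]
    exact ⟨.evict _, .load _⟩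

/-- The roles are exchanged compared to the keys: the entries of `H` and `S` are only read and stay
put, while the partial sums of row `i` are brought in and retired with the row. -/
theorem can_query_row {i : Fin n} (hM : κ.card * J.card + (W.card + J.card + 1) ≤ M)
    (hW : ∀ m ∈ κ, m.supp ⊆ W) (hT : ∀ m ∈ κ, ∀ c ∈ J, (i, m, c) ∉ T) :
    (attentionDAG n d g).Can (M + 2) (querySpec κ J W none T) (2 * (W.card + J.card + 1))
      (querySpec κ J W none (T ∪ {i} ×ˢ κ ×ˢ J)) := by
  have hcard : (queryWorkspace κ J W i).card ≤ M := (card_queryWorkspace_le i).trans hM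
  have hfit : ∀ T : Finset (Triple n d g), Fits (querySpec κ J W (some i) T) M := fun T =>
    ⟨_, hcard, fun v hv => mem_queryWorkspace (by simp) hv⟩
  have hloop := Can.loop (G := attentionDAG n d g) (M := M + 2) (k := 0) κ
    (fun t => querySpec κ J W (some i) (T ∪ {i} ×ˢ t ×ˢ J)) fun t _ m hm hmt => by
    have h := can_query_entry (T := T ∪ {i} ×ˢ t ×ˢ J) hfit hm (hW m hm)
      (fun c hc => by simp [hT m hm c hc, hmt])
    have heq : (T ∪ {i} ×ˢ t ×ˢ J) ∪ (J.image fun c => (i, m, c)) =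
        T ∪ {i} ×ˢ (insert m t) ×ˢ J := by
      ext ⟨l', m', c'⟩
      simp only [Finset.mem_union, Finset.mem_product, Finset.mem_singleton, Finset.mem_image,
        Finset.mem_insert, Prod.mk.injEq]
      constructor
      · rintro ((h | h) | ⟨c, hc, rfl, rfl, rfl⟩) <;> tauto
      · rintro (h | ⟨rfl, rfl | h, h'⟩) <;> tauto
    rwa [heq] at h
  simp only [Finset.empty_product, Finset.product_empty, Finset.union_empty, mul_zero] at hloop
  have hcard' : (queryWorkspace κ J W i).card ≤ M + 2 := by omega
  have h1 := Can.transfer (G := attentionDAG n d g) (M := M + 2) (S := querySpec κ J W none T)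
    (S' := querySpec κ J W (some i) T) (queryInputs J W i) (queryWorkspace κ J W i) hcard'
    (fun v hv => mem_queryWorkspace (by simp) hv) (fun v hv => mem_queryWorkspace (by simp) hv)
    (fun v hv => (transfer_querySpec hv).2) (fun v hv => querySpec_of_notMem_queryInputs hv)
  have h2 := fun T : Finset (Triple n d g) => Can.transfer (G := attentionDAG n d g) (M := M + 2)
    (S := querySpec κ J W (some i) T) (S' := querySpec κ J W none T) (queryInputs J W i)
    (queryWorkspace κ J W i) hcard'
    (fun v hv => mem_queryWorkspace (by simp) hv) (fun v hv => mem_queryWorkspace (by simp) hv)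
    (fun v hv => (transfer_querySpec hv).1) (fun v hv => (querySpec_of_notMem_queryInputs hv).symm)
  have := card_queryInputs_le (g := g) J W i
  exact ((h1.trans hloop).trans (h2 _)).mono (by omega)

theorem can_query_block (hn : 1 ≤ n) (hM : κ.card * J.card + (W.card + J.card + 1) ≤ M)
    (hW : ∀ m ∈ κ, m.supp ⊆ W) (hT : ∀ i, ∀ m ∈ κ, ∀ c ∈ J, (i, m, c) ∉ T) :
    (attentionDAG n d g).Can (M + 2) (querySpec ∅ ∅ ∅ none T)
      (2 * (κ.card * J.card) + n * (2 * (W.card + J.card + 1)))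
      (querySpec ∅ ∅ ∅ none (T ∪ Finset.univ ×ˢ κ ×ˢ J)) := by
  have hcard : (queryWorkspace κ J W (⟨0, hn⟩ : Fin n)).card ≤ M + 2 :=
    (card_queryWorkspace_le _).trans (by omega)
  have hempty : ∀ (T : Finset (Triple n d g)) v,
      ¬ (querySpec (n := n) (∅ : Finset (AttMonomial d g)) ∅ ∅ none T v).InFast := by
    intro T v
    cases v with
    | U₁ i m => by_cases h : m = AttMonomial.one <;> simp [querySpec, InFast, h]
    | _ => simp [querySpec, InFast]
  have hout : ∀ (T : Finset (Triple n d g)), ∀ v ∉ (κ ×ˢ J).image (fun p => res p.1 p.2),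
      querySpec κ J W none T v = querySpec ∅ ∅ ∅ none T v := by
    intro T v hv
    simp only [Finset.mem_image, Finset.mem_product, not_exists, not_and, Prod.forall] at hv
    cases v with
    | H m j =>
      have := hv m (some j)
      simp only [querySpec, Finset.notMem_empty, false_and, if_false]
      exact if_neg fun h => this h rfl
    | S m =>
      have := hv m none
      simp only [querySpec, Finset.notMem_empty, false_and, if_false]
      exact if_neg fun h => this h rfl
    | _ => simp [querySpec]
  have hrow := Can.loop (G := attentionDAG n d g) (M := M + 2) (k := 2 * (W.card + J.card + 1))
    (Finset.univ : Finset (Fin n)) (fun t => querySpec κ J W none (T ∪ t ×ˢ κ ×ˢ J))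
    fun t _ l _ hlt => by
    have h := can_query_row (T := T ∪ t ×ˢ κ ×ˢ J) (i := l) hM hW
      (fun m hm c hc => by simp [hT l m hm c hc, hlt])
    have heq : (T ∪ t ×ˢ κ ×ˢ J) ∪ {l} ×ˢ κ ×ˢ J = T ∪ (insert l t) ×ˢ κ ×ˢ J := by
      ext ⟨l', m', c'⟩
      simp only [Finset.mem_union, Finset.mem_product, Finset.mem_singleton, Finset.mem_insert]
      tauto
    rwa [heq] at h
  simp only [Finset.empty_product, Finset.union_empty, Finset.card_univ,
    Fintype.card_fin] at hrow
  have h1 := Can.transfer (G := attentionDAG n d g) (M := M + 2) (S := querySpec ∅ ∅ ∅ none T)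
    (S' := querySpec κ J W none T) ((κ ×ˢ J).image (fun p => res p.1 p.2))
    (queryWorkspace κ J W ⟨0, hn⟩) hcard
    (fun v hv => absurd hv (hempty T v)) (fun v hv => mem_queryWorkspace (by simp) hv)
    (fun v hv => by
      obtain ⟨⟨m, c⟩, hp, rfl⟩ := Finset.mem_image.1 hv
      rw [querySpec_res, querySpec_res, if_pos (Finset.mem_product.1 hp), if_neg (by simp)]
      exact .load _) (hout T)
  have h2 := fun T : Finset (Triple n d g) => Can.transfer (G := attentionDAG n d g) (M := M + 2)
    (S := querySpec κ J W none T) (S' := querySpec ∅ ∅ ∅ none T)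
    ((κ ×ˢ J).image (fun p => res p.1 p.2))
    (queryWorkspace κ J W ⟨0, hn⟩) hcard (fun v hv => mem_queryWorkspace (by simp) hv)
    (fun v hv => absurd hv (hempty _ v))
    (fun v hv => by
      obtain ⟨⟨m, c⟩, hp, rfl⟩ := Finset.mem_image.1 hv
      rw [querySpec_res, querySpec_res, if_pos (Finset.mem_product.1 hp), if_neg (by simp)]
      exact .evict _) (fun v hv => (hout _ v hv).symm)
  have : ((κ ×ˢ J).image (fun p => (res p.1 p.2 : AttNode n d g))).card ≤ κ.card * J.card := by
    rw [← Finset.card_product]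
    exact Finset.card_image_le
  exact ((h1.trans hrow).trans (h2 _)).mono (by omega)

end Query

theorem can_queries {α β : Type} [Fintype α] [DecidableEq α] [Fintype β] [DecidableEq β]
    {M F t w : ℕ} (hn : 1 ≤ n) (cls : AttMonomial d g → α) (blk : Option (Fin d) → β)
    (W : α → Finset (Fin d)) (hW : ∀ m, m.supp ⊆ W (cls m)) (hw : ∀ a, (W a).card ≤ w)
    (hF : ∀ a, (Finset.univ.filter fun m => cls m = a).card ≤ F)
    (ht : ∀ b, (Finset.univ.filter fun c => blk c = b).card ≤ t)
    (hM : F * t + (w + t + 1) ≤ M) :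
    (attentionDAG n d g).Can (M + 2) (querySpec ∅ ∅ ∅ none ∅)
      (Fintype.card α * Fintype.card β * (2 * (F * t) + n * (2 * (w + t + 1))))
      (querySpec ∅ ∅ ∅ none Finset.univ) := by
  have hloop := Can.loop (G := attentionDAG n d g) (M := M + 2)
    (k := 2 * (F * t) + n * (2 * (w + t + 1))) (Finset.univ : Finset (α × β))
    (fun P => querySpec ∅ ∅ ∅ none
      (Finset.univ.filter fun e : Triple n d g => (cls e.2.1, blk e.2.2) ∈ P))
    fun P _ ab _ hab => by
      obtain ⟨a, b⟩ := ab
      have hprod : (Finset.univ.filter fun m => cls m = a).card *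
          (Finset.univ.filter fun c => blk c = b).card ≤ F * t := Nat.mul_le_mul (hF a) (ht b)
      have hwa := hw a
      have htb := ht b
      have h := can_query_block (M := M) (κ := Finset.univ.filter fun m => cls m = a)
        (J := Finset.univ.filter fun c => blk c = b) (W := W a)
        (T := Finset.univ.filter fun e : Triple n d g => (cls e.2.1, blk e.2.2) ∈ P) hn (by omega)
        (fun m hm => (Finset.mem_filter.1 hm).2 ▸ hW m)
        (fun l m hm c hc hmem => by
          rw [Finset.mem_filter] at hm hc hmem
          exact hab (by simpa [hm.2, hc.2] using hmem.2))
      have heq : ((Finset.univ.filter fun e : Triple n d g => (cls e.2.1, blk e.2.2) ∈ P) ∪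
          Finset.univ ×ˢ (Finset.univ.filter fun m => cls m = a) ×ˢ
            (Finset.univ.filter fun c => blk c = b)) =
          Finset.univ.filter fun e : Triple n d g => (cls e.2.1, blk e.2.2) ∈ insert (a, b) P := by
        ext ⟨l, m, c⟩
        simp [or_comm]
      rw [heq] at h
      refine h.mono (add_le_add (by omega) (Nat.mul_le_mul_left _ (by omega)))
  simpa using hloop

/-! ### Computing the output -/

/-- The state of the pebbling while the output is computed: the entries in `P` are done, and the
operands of the entry `act` are in fast memory. -/
def outSpec (act : Option (Fin n × Fin d)) (P : Finset (Fin n × Fin d)) :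
    AttNode n d g → PebbleStatus (AttNode n d g)
  | Q _ _ | K _ _ | V _ _ => stored ∅
  | H m j => stored (operands (H m j))
  | S m => stored (operands (S m))
  | A i j => if act = some (i, j) then cached (operands (A i j)) else stored (operands (A i j))
  | D i => if ∃ j, act = some (i, j) then cached (operands (D i)) else stored (operands (D i))
  | out i j => if (i, j) ∈ P then stored (operands (out i j)) else idle
  | U₁ _ _ | U₂ _ _ | prodH _ _ _ | prodA _ _ _ | prodD _ _ => idle

/-- The cost `6` is made up of two loads, one save and three evictions, which `Can.transfer` charges
one unit each. -/
theorem can_out_entry {M : ℕ} (hM : 3 ≤ M) {P : Finset (Fin n × Fin d)} {i : Fin n} {j : Fin d}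
    (hP : (i, j) ∉ P) : (attentionDAG n d g).Can M (outSpec none P) 6
      (outSpec none (insert (i, j) P)) := by
  set L : Finset (AttNode n d g) := {A i j, D i} with hL
  have hLcard : L.card ≤ 2 := Finset.card_le_two
  have hin : ∀ v ∉ L, (outSpec (some (i, j)) P : AttNode n d g → _) v = outSpec none P v := by
    intro v hv
    simp only [hL, Finset.mem_insert, Finset.mem_singleton, not_or] at hv
    cases v with
    | A i' j' =>
      have := hv.1
      simp only [A.injEq, not_and] at this
      simp only [outSpec, Option.some.injEq, Prod.mk.injEq, reduceCtorEq, if_false]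
      exact if_neg fun h => this h.1.symm h.2.symm
    | D i' =>
      have := hv.2
      simp only [D.injEq] at this
      simp only [outSpec, Option.some.injEq, Prod.mk.injEq, reduceCtorEq, exists_false, if_false]
      exact if_neg fun ⟨_, h⟩ => this h.1.symm
    | _ => rfl
  have hidle : ∀ P' v, ¬ ((outSpec none P' : AttNode n d g → _) v).InFast := by
    intro P' v
    cases v with
    | out i' j' => by_cases h : (i', j') ∈ P' <;> simp [outSpec, InFast, h]
    | _ => simp [outSpec, InFast]
  have hact : ∀ v, ((outSpec (some (i, j)) P : AttNode n d g → _) v).InFast → v ∈ L := by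
    intro v hv
    by_contra h
    rw [hin v h] at hv
    exact hidle P v hv
  have hA : (outSpec (some (i, j)) P : AttNode n d g → _) (A i j) = cached (operands (A i j)) := by
    simp [outSpec]
  have hD : (outSpec (some (i, j)) P : AttNode n d g → _) (D i) = cached (operands (D i)) := by
    simp [outSpec]
  have hfit : Fits (outSpec (some (i, j)) P : AttNode n d g → _) 2 := ⟨L, hLcard, hact⟩
  have h1 := Can.transfer (G := attentionDAG n d g) (M := M) (S := outSpec none P)
    (S' := outSpec (some (i, j)) P) L L (by omega) (fun v hv => absurd hv (hidle P v)) hact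
    (fun v hv => by
      simp only [hL, Finset.mem_insert, Finset.mem_singleton] at hv
      rcases hv with rfl | rfl
      · rw [hA]
        exact .load _
      · rw [hD]
        simp only [outSpec, reduceCtorEq, exists_false, if_false]
        exact .load _) hin
  have hout : (outSpec (some (i, j)) P : AttNode n d g → _) (out i j) = idle := by
    simp [outSpec, hP]
  have h2 := Can.fresh (G := attentionDAG n d g) (M := M - 1)
    (hfit.mono (by omega)) hout ⟨A i j, by simp [attentionDAG, operands]⟩ (fun u hu => by
      have hu' : u = A i j ∨ u = D i := by simpa [attentionDAG, operands] using hu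
      rcases hu' with rfl | rfl
      · exact Or.inl hA
      · exact Or.inl hD)
  rw [Nat.sub_add_cancel (by omega)] at h2
  have hfit' : Fits (Function.update (outSpec (some (i, j)) P : AttNode n d g → _) (out i j)
      (held ((attentionDAG n d g).pred (out i j)))) M := (hfit.update _ _).mono (by omega)
  have h3 := Can.save (G := attentionDAG n d g) hfit'
    (v := out i j) (X := (attentionDAG n d g).pred (out i j)) (by simp)
  rw [Function.update_idem] at h3
  have h4 := Can.transfer (G := attentionDAG n d g) (M := M)
    (S := Function.update (outSpec (some (i, j)) P : AttNode n d g → _) (out i j)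
      (cached (operands (out i j))))
    (S' := outSpec none (insert (i, j) P)) (insert (out i j) L) (insert (out i j) L)
    ((Finset.card_insert_le _ _).trans (by omega))
    (fun v hv => by
      by_cases h : v = out i j
      · exact h ▸ Finset.mem_insert_self _ _
      · rw [Function.update_of_ne h] at hv
        exact Finset.mem_insert_of_mem (hact v hv))
    (fun v hv => absurd hv (hidle _ v))
    (fun v hv => by
      simp only [hL, Finset.mem_insert, Finset.mem_singleton] at hv
      rcases hv with rfl | rfl | rfl
      · rw [Function.update_self]
        simp only [outSpec, Finset.mem_insert_self, if_true]
        exact .evict _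
      · rw [Function.update_of_ne (by simp), hA]
        simp only [outSpec, reduceCtorEq, if_false]
        exact .evict _
      · rw [Function.update_of_ne (by simp), hD]
        simp only [outSpec, reduceCtorEq, exists_false, if_false]
        exact .evict _)
    (fun v hv => by
      rw [Finset.mem_insert, not_or] at hv
      rw [Function.update_of_ne hv.1, hin v hv.2]
      cases v with
      | out i' j' =>
        have := hv.1
        simp only [out.injEq, not_and] at this
        have h' : ¬ (i', j') = (i, j) := fun h => this (Prod.mk.inj h).1 (Prod.mk.inj h).2
        simp only [outSpec, Finset.mem_insert, h', false_or]
      | _ => rfl)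
  refine (((h1.trans h2).trans h3).trans h4).mono ?_
  have := Finset.card_insert_le (out i j) L
  omega

theorem isFinal_of_sat {c : PebbleConfig (AttNode n d g)}
    (hc : Sat (outSpec none Finset.univ) c) : (attentionDAG n d g).IsFinal c := by
  -- For degenerate parameters other nodes than the outputs may be sinks. The nodes left `idle` at
  -- the end always have a child, and all others are stored fully computed.
  have hsink : ∀ v : AttNode n d g, (attentionDAG n d g).IsSink v →
      (outSpec none Finset.univ : AttNode n d g → _) v = stored (operands v) := by
    intro v hv
    cases v with
    | U₁ i m => exact absurd (show U₁ i m ∈ operands (prodD i m) by simp [operands]) (hv _)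
    | U₂ l m => exact absurd (show U₂ l m ∈ operands (S m) by simp [operands]) (hv _)
    | prodH m l j => exact absurd (show prodH m l j ∈ operands (H m j) by simp [operands]) (hv _)
    | prodA i m j => exact absurd (show prodA i m j ∈ operands (A i j) by simp [operands]) (hv _)
    | prodD i m => exact absurd (show prodD i m ∈ operands (D i) by simp [operands]) (hv _)
    | _ => simp [outSpec, operands]
  intro v hv
  have h := hc v
  rw [hsink v hv] at h
  exact ⟨h.2.1, h.2.2⟩

theorem sat_initial : Sat (keySpec ∅ ∅ ∅ none ∅) (attentionDAG n d g).initial := by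
  intro v
  cases v with
  | U₁ i m =>
    by_cases h : m = AttMonomial.one
    · simp [keySpec, Holds, initial, IsSource, attentionDAG, operands_U₁,
        AttMonomial.supp_eq_empty, h]
    · simp [keySpec, Holds, initial, h]
  | U₂ l m =>
    by_cases h : m = AttMonomial.one
    · simp [keySpec, Holds, initial, IsSource, attentionDAG, operands_U₂,
        AttMonomial.supp_eq_empty, h]
    · simp [keySpec, Holds, initial, h]
  | _ => simp [keySpec, Holds, initial, IsSource, attentionDAG, operands, termsOf_empty]

end AttNode

open AttNode CompDAG PebbleStatus in
/-- The cost of a pebbling that processes the monomials in the classes of `cls` and the columns in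
the blocks of `blk`. -/
theorem attention_cost_upper {α β : Type} [Fintype α] [DecidableEq α] [Fintype β] [DecidableEq β]
    {n d g M F t w : ℕ} (hn : 1 ≤ n) (cls : AttMonomial d g → α) (blk : Option (Fin d) → β)
    (W : α → Finset (Fin d)) (hW : ∀ m, m.supp ⊆ W (cls m)) (hw : ∀ a, (W a).card ≤ w)
    (hF : ∀ a, (Finset.univ.filter fun m => cls m = a).card ≤ F)
    (ht : ∀ b, (Finset.univ.filter fun c => blk c = b).card ≤ t)
    (hM : F * t + w + t + 3 ≤ M) :
    ∃ k ∈ (attentionDAG n d g).ioCosts M,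
      k ≤ 4 * (Fintype.card α * Fintype.card β * (F * t + n * (w + t + 1))) + 6 * (n * d) := by
  obtain ⟨M, rfl⟩ : ∃ M', M = M' + 2 := ⟨M - 2, by omega⟩
  have h1 := can_keys (M := M) hn cls blk W hW hw hF ht (by omega)
  have h2 := can_queries (M := M) hn cls blk W hW hw hF ht (by omega)
  have hres : ∀ (m : AttMonomial d g) c, (operands (res m c : AttNode n d g)).Nonempty := by
    intro m c
    rw [operands_res, Finset.image_nonempty]
    exact ⟨⟨0, hn⟩, Finset.mem_univ _⟩
  have hacc : ∀ (i : Fin n) c, (operands (acc i c : AttNode n d g)).Nonempty := by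
    intro i c
    rw [operands_acc, Finset.image_nonempty]
    exact ⟨AttMonomial.one, Finset.mem_univ _⟩
  -- All products have been aggregated, so the retired sums are complete; as `n ≥ 1` they have been
  -- started, hence are in slow memory.
  have h12 : (attentionDAG n d g).Can (M + 2) (keySpec ∅ ∅ ∅ none Finset.univ) 0
      (querySpec ∅ ∅ ∅ none ∅) := by
    refine Can.of_entails fun v => ?_
    cases v with
    | H m j =>
      have := retired_entails_stored (hres m (some j))
      simpa [keySpec, querySpec, termsOf_univ, res] using this
    | S m =>
      have := retired_entails_stored (hres m none)
      simpa [keySpec, querySpec, termsOf_univ, res] using this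
    | U₂ l m =>
      by_cases h : m = AttMonomial.one
      · simpa [keySpec, querySpec, h] using stored_entails_idle _
      · simpa [keySpec, querySpec, h] using Entails.refl _
    | A i j => simpa [keySpec, querySpec, prodsOf_empty] using Entails.refl _
    | D i => simpa [keySpec, querySpec, prodsOf_empty] using Entails.refl _
    | _ => simpa [keySpec, querySpec] using Entails.refl _
  have h23 : (attentionDAG n d g).Can (M + 2) (querySpec ∅ ∅ ∅ none Finset.univ) 0
      (outSpec none ∅) := by
    refine Can.of_entails fun v => ?_
    cases v with
    | A i j =>
      have := retired_entails_stored (hacc i (some j))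
      simpa [outSpec, querySpec, prodsOf_univ, acc] using this
    | D i =>
      have := retired_entails_stored (hacc i none)
      simpa [outSpec, querySpec, prodsOf_univ, acc] using this
    | U₁ l m =>
      by_cases h : m = AttMonomial.one
      · simpa [outSpec, querySpec, h] using stored_entails_idle _
      · simpa [outSpec, querySpec, h] using Entails.refl _
    | _ => simpa [outSpec, querySpec] using Entails.refl _
  have h3 := Can.loop (G := attentionDAG n d g) (M := M + 2) (k := 6)
    (Finset.univ : Finset (Fin n × Fin d)) (fun P => outSpec none P)
    fun P _ e _ he => can_out_entry (by omega) he
  obtain ⟨c, k, hk, hreach, hc⟩ := ((((h1.trans h12).trans h2).trans h23).trans h3) _ sat_initial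
  refine ⟨k, ⟨c, isFinal_of_sat hc, hreach⟩, hk.trans (le_of_eq ?_)⟩
  simp only [Finset.card_univ, Fintype.card_prod, Fintype.card_fin]
  ring

/-! ## Classes of monomials -/

theorem card_filter_div_eq_le {α : Type*} [Fintype α] {f : α → ℕ} (hf : Function.Injective f)
    {b : ℕ} (hb : 1 ≤ b) (k : ℕ) : (Finset.univ.filter fun a => f a / b = k).card ≤ b := by
  refine (Finset.card_le_card_of_injOn (t := Finset.range b) (fun a => f a % b) (fun a _ => ?_)
    ?_).trans_eq (Finset.card_range b)
  · simpa using Nat.mod_lt _ hb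
  · intro a ha a' ha' h
    have h1 := (Finset.mem_filter.1 ha).2
    have h2 := (Finset.mem_filter.1 ha').2
    apply hf
    rw [← Nat.div_add_mod (f a) b, ← Nat.div_add_mod (f a') b, h1, h2]
    exact congrArg _ h

namespace AttMonomial

variable {d g b : ℕ}

/-- The block, of size `b`, of a variable. -/
def block (b : ℕ) (a : Fin d) : Fin (d / b + 1) :=
  ⟨a / b, Nat.lt_succ_of_le (Nat.div_le_div_right a.2.le)⟩

theorem card_filter_block_le (hb : 1 ≤ b) (k : Fin (d / b + 1)) :
    (Finset.univ.filter fun a : Fin d => block b a = k).card ≤ b := by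
  refine le_trans (Finset.card_le_card fun a ha => ?_)
    (card_filter_div_eq_le (Fin.val_injective (n := d)) hb k)
  simpa [block, Fin.ext_iff] using ha

/-- The degrees of a monomial in the blocks of variables. -/
def blockDegree (b : ℕ) (m : AttMonomial d g) : AttMonomial (d / b + 1) g :=
  have h : ∑ k, ∑ a with block b a = k, (m.1 a : ℕ) ≤ g := by
    rw [Finset.sum_fiberwise]
    exact m.2
  ⟨fun k => ⟨∑ a with block b a = k, (m.1 a : ℕ), Nat.lt_succ_of_le
    ((Finset.single_le_sum (f := fun k => ∑ a with block b a = k, (m.1 a : ℕ))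
      (fun _ _ => Nat.zero_le _) (Finset.mem_univ k)).trans h)⟩, h⟩

/-- The variables of the blocks that occur in `μ`. -/
def blockVars (b : ℕ) (μ : AttMonomial (d / b + 1) g) : Finset (Fin d) :=
  Finset.univ.filter fun a => μ.1 (block b a) ≠ 0

theorem supp_subset_blockVars (m : AttMonomial d g) : m.supp ⊆ blockVars b (blockDegree b m) := by
  intro a ha
  rw [mem_supp] at ha
  rw [blockVars, Finset.mem_filter]
  refine ⟨Finset.mem_univ _, fun h => ha ?_⟩
  have h' : ∑ a' with block b a' = block b a, (m.1 a' : ℕ) = 0 := congrArg Fin.val h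
  exact Fin.ext (Finset.sum_eq_zero_iff.1 h' a (by simp))

theorem card_supp_le (m : AttMonomial d g) : m.supp.card ≤ g := by
  refine le_trans ?_ m.2
  rw [Finset.card_eq_sum_ones]
  refine (Finset.sum_le_sum fun a ha => ?_).trans
    (Finset.sum_le_sum_of_subset (Finset.subset_univ _))
  exact Nat.one_le_iff_ne_zero.2 fun h => mem_supp.1 ha (Fin.ext h)

/-- A degree vector of total degree at most `g` involves at most `g` blocks. -/
theorem card_blockVars_le (hb : 1 ≤ b) (μ : AttMonomial (d / b + 1) g) :
    (blockVars b μ).card ≤ g * b := by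
  have h : blockVars b μ ⊆ μ.supp.biUnion fun k => Finset.univ.filter fun a => block b a = k := by
    intro a ha
    simpa [mem_supp, blockVars] using ha
  refine (Finset.card_le_card h).trans (Finset.card_biUnion_le.trans ?_)
  refine (Finset.sum_le_card_nsmul _ _ b fun k _ => card_filter_block_le hb k).trans ?_
  exact Nat.mul_le_mul_right b μ.card_supp_le

theorem card_filter_blockDegree_le (hb : 1 ≤ b) (μ : AttMonomial (d / b + 1) g) :
    (Finset.univ.filter fun m : AttMonomial d g => blockDegree b m = μ).card
      ≤ (g * b + g).choose g := by
  refine (Finset.card_le_card (t := Finset.univ.filter fun m => m.supp ⊆ blockVars b μ)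
    fun m hm => ?_).trans ?_
  · rw [Finset.mem_filter] at hm ⊢
    exact ⟨Finset.mem_univ _, hm.2 ▸ supp_subset_blockVars m⟩
  · rw [card_supp_subset]
    exact Nat.choose_le_choose _ (Nat.add_le_add_right (card_blockVars_le hb μ) g)

end AttMonomial

theorem attention_cost_blocks {n d g M b : ℕ} (hn : 1 ≤ n) (hb : 1 ≤ b)
    (hM : (g * b + g).choose g * b + g * b + b + 3 ≤ M) :
    ∃ k ∈ (attentionDAG n d g).ioCosts M,
      k ≤ 4 * ((d / b + 1 + g).choose g * (d / b + 1) *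
        ((g * b + g).choose g * b + n * (g * b + b + 1))) + 6 * (n * d) := by
  -- The additional column `none`, which stands for `S` and `D`, gets the number `d`; so the `d + 1`
  -- columns fit in `d / b + 1` blocks.
  have hinj : Function.Injective fun c : Option (Fin d) => c.elim d fun j => (j : ℕ) := by
    rintro (_ | j) (_ | j') h
    · rfl
    · exact absurd h (by simpa using j'.2.ne')
    · exact absurd h (by simpa using j.2.ne)
    · simpa [Fin.ext_iff] using h
  have hle : ∀ c : Option (Fin d), c.elim d (fun j => (j : ℕ)) ≤ d := by
    rintro (_ | j)
    · exact le_rfl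
    · exact j.2.le
  have h := attention_cost_upper (M := M) hn (AttMonomial.blockDegree (d := d) (g := g) b)
    (fun c => (⟨c.elim d (fun j => (j : ℕ)) / b,
      Nat.lt_succ_of_le (Nat.div_le_div_right (hle c))⟩ : Fin (d / b + 1)))
    (AttMonomial.blockVars b) AttMonomial.supp_subset_blockVars
    (AttMonomial.card_blockVars_le hb) (AttMonomial.card_filter_blockDegree_le hb)
    (t := b) (fun k => by
      refine le_trans (Finset.card_le_card fun c hc => ?_) (card_filter_div_eq_le hinj hb k)
      rw [Finset.mem_filter] at hc ⊢
      exact ⟨hc.1, congrArg Fin.val hc.2⟩) hM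
  rwa [AttMonomial.card_eq, Fintype.card_fin] at h

/-! ## Estimates -/

theorem pow_le_factorial_mul_choose (d g : ℕ) :
    (d : ℝ) ^ g ≤ g.factorial * ((d + g).choose g : ℝ) := by
  have h : d ^ g ≤ g.factorial * (d + g).choose g := by
    rw [← Nat.ascFactorial_eq_factorial_mul_choose]
    exact (Nat.pow_le_pow_left (Nat.le_succ d) g).trans (Nat.pow_succ_le_ascFactorial _ _)
  exact_mod_cast h

theorem factorial_mul_choose_le_pow (a g : ℕ) :
    g.factorial * (a.choose g : ℝ) ≤ (a : ℝ) ^ g := by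
  have h : g.factorial * a.choose g ≤ a ^ g := by
    rw [← Nat.descFactorial_eq_factorial_mul_choose]
    exact Nat.descFactorial_le_pow _ _
  exact_mod_cast h

theorem natCast_le_two_pow (g : ℕ) : (g : ℝ) + 1 ≤ 2 ^ g := by
  exact_mod_cast Nat.lt_two_pow_self (n := g)

theorem pow_self_le (g : ℕ) : (g : ℝ) ^ g ≤ g.factorial * (2.72 : ℝ) ^ g := by
  have h := Real.pow_div_factorial_le_exp (x := g) (by positivity) g
  rw [div_le_iff₀ (by positivity), ← Real.exp_one_pow] at h
  refine h.trans ?_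
  rw [mul_comm]
  gcongr
  linarith [Real.exp_one_lt_d9]

section Estimates

variable {d g : ℕ} {x : ℝ}

/-- Raising to the power `g + 1` and using `d^g ≤ g! r` gives `(x^g)^(g+1) ≤ (d r)^g ≤ g! r^(g+1)`.
-/
theorem pow_le_choose_mul (hg : 1 ≤ g) (hx : 0 ≤ x)
    (hM : x ^ (g + 1) ≤ d * ((d + g).choose g : ℝ)) : x ^ g ≤ (d + g).choose g * g := by
  set r : ℝ := ((d + g).choose g : ℝ)
  have hr : 0 ≤ r := Nat.cast_nonneg _
  have hg' : (1 : ℝ) ≤ g := by exact_mod_cast hg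
  refine le_of_pow_le_pow_left₀ (n := g + 1) (by omega) (by positivity) ?_
  calc (x ^ g) ^ (g + 1) = (x ^ (g + 1)) ^ g := by rw [← pow_mul, ← pow_mul, mul_comm]
    _ ≤ (d * r) ^ g := by gcongr
    _ = d ^ g * r ^ g := mul_pow _ _ _
    _ ≤ (g.factorial * r) * r ^ g := by
      gcongr
      exact pow_le_factorial_mul_choose d g
    _ ≤ (g ^ (g + 1) * r) * r ^ g := by
      gcongr
      have h1 : (g.factorial : ℝ) ≤ (g : ℝ) ^ g := by exact_mod_cast Nat.factorial_le_pow g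
      exact h1.trans (pow_le_pow_right₀ hg' (Nat.le_succ g))
    _ = (r * g) ^ (g + 1) := by ring

/-- If `d < 2g`, then `d r ≤ 2 · 16^g`, too small for `x^(g+1)` with `x ≥ 1000`. -/
theorem two_mul_le_of_large (hx : 1000 ≤ x)
    (hM : x ^ (g + 1) ≤ d * ((d + g).choose g : ℝ)) : 2 * g ≤ d := by
  by_contra! hd
  have h1 : ((d + g).choose g : ℝ) ≤ 8 ^ g := by
    have : (d + g).choose g ≤ 8 ^ g := by
      refine (Nat.choose_le_two_pow _ _).trans ?_
      rw [show (8 : ℕ) = 2 ^ 3 by norm_num, ← pow_mul]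
      exact Nat.pow_le_pow_right (by norm_num) (by omega)
    exact_mod_cast this
  have h2 : (d : ℝ) ≤ 2 * 2 ^ g := by
    have : (d : ℝ) < 2 * g := by exact_mod_cast hd
    linarith [natCast_le_two_pow g]
  have h3 : x ^ (g + 1) ≤ 2 * 16 ^ g := by
    calc x ^ (g + 1) ≤ d * ((d + g).choose g : ℝ) := hM
      _ ≤ (2 * 2 ^ g) * 8 ^ g := by gcongr
      _ = 2 * 16 ^ g := by rw [mul_assoc, ← mul_pow]; norm_num
  have h4 : (1000 : ℝ) * 16 ^ g ≤ x ^ (g + 1) := by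
    calc (1000 : ℝ) * 16 ^ g ≤ x * x ^ g := by
          gcongr
          linarith
      _ = x ^ (g + 1) := by ring
  have : (0 : ℝ) < 16 ^ g := by positivity
  linarith

/-- From `g! r ≤ (d+g)^g` and `d + g ≤ 1.5 d`. The factorial is traded below for `g^g` at the price
of `e^g`. -/
theorem factorial_mul_pow_le (hx : 1000 ≤ x)
    (hM : x ^ (g + 1) ≤ d * ((d + g).choose g : ℝ)) :
    g.factorial * x ^ (g + 1) ≤ (1.5 : ℝ) ^ g * d ^ (g + 1) := by
  have hd : 2 * (g : ℝ) ≤ d := by exact_mod_cast two_mul_le_of_large hx hM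
  calc g.factorial * x ^ (g + 1) ≤ g.factorial * (d * ((d + g).choose g : ℝ)) := by gcongr
    _ = d * (g.factorial * ((d + g).choose g : ℝ)) := by ring
    _ ≤ d * ((d + g : ℕ) : ℝ) ^ g := by
      gcongr
      exact factorial_mul_choose_le_pow _ _
    _ ≤ d * (1.5 * d) ^ g := by
      gcongr
      push_cast
      linarith
    _ = (1.5 : ℝ) ^ g * d ^ (g + 1) := by rw [mul_pow]; ring

/-- The constant is `8.16 = 1.5 · 2 · 2.72`: the factor `2` absorbs `g + 1 ≤ 2^g`, and `2.72`
exceeds `e`. -/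
theorem mul_succ_le_of_large (hx : 1000 ≤ x)
    (hM : x ^ (g + 1) ≤ d * ((d + g).choose g : ℝ)) : x * (g + 1) ≤ 8.16 * d := by
  refine le_of_pow_le_pow_left₀ (n := g + 1) (by omega) (by positivity) ?_
  have h1 := factorial_mul_pow_le hx hM
  have h2 := pow_self_le (g + 1)
  push_cast [Nat.factorial_succ] at h2
  have h3 := natCast_le_two_pow g
  have hf : (0 : ℝ) < g.factorial := by positivity
  refine le_of_mul_le_mul_left ?_ hf
  calc (g.factorial : ℝ) * (x * (g + 1)) ^ (g + 1)
      = (g.factorial * x ^ (g + 1)) * ((g : ℝ) + 1) ^ (g + 1) := by rw [mul_pow]; ring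
    _ ≤ ((1.5 : ℝ) ^ g * d ^ (g + 1)) * ((2 ^ g * g.factorial) * (2.72 : ℝ) ^ (g + 1)) := by
      gcongr
      refine h2.trans ?_
      gcongr
    _ = g.factorial * ((3 : ℝ) ^ g * (2.72 * d) ^ (g + 1)) := by
      rw [show (3 : ℝ) = 1.5 * 2 by norm_num, mul_pow (1.5 : ℝ), mul_pow (2.72 : ℝ)]
      ring
    _ ≤ g.factorial * ((3 : ℝ) ^ (g + 1) * (2.72 * d) ^ (g + 1)) := by
      gcongr
      · norm_num
      · omega
    _ = g.factorial * (8.16 * d) ^ (g + 1) := by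
      rw [← mul_pow]
      norm_num [← mul_assoc]

/-- The sharper constant `6` is what makes `g b ≤ d` for `b ≤ x / 6`. It results from `1.5 · 1.47 ·
2.72 < 6`, where `1.47^g` absorbs the spare factor `g`. -/
theorem mul_le_of_large (hx : 1000 ≤ x)
    (hM : x ^ (g + 1) ≤ d * ((d + g).choose g : ℝ)) : g * x ≤ 6 * d := by
  refine le_of_pow_le_pow_left₀ (n := g + 1) (by omega) (by positivity) ?_
  have h1 := factorial_mul_pow_le hx hM
  have h2 := pow_self_le g
  have h3 : (g : ℝ) ≤ 6 * 1.47 ^ g := by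
    have := one_add_mul_le_pow (a := (0.47 : ℝ)) (by norm_num) g
    norm_num at this ⊢
    linarith [(Nat.cast_nonneg g : (0 : ℝ) ≤ g)]
  have hf : (0 : ℝ) < g.factorial := by positivity
  refine le_of_mul_le_mul_left ?_ hf
  calc (g.factorial : ℝ) * (g * x) ^ (g + 1)
      = (g.factorial * x ^ (g + 1)) * (g * (g : ℝ) ^ g) := by rw [mul_pow]; ring
    _ ≤ ((1.5 : ℝ) ^ g * d ^ (g + 1)) * ((6 * 1.47 ^ g) * (g.factorial * (2.72 : ℝ) ^ g)) := by
      gcongr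
    _ = g.factorial * ((6 * d ^ (g + 1)) * (1.5 * 1.47 * 2.72) ^ g) := by
      rw [mul_pow, mul_pow]
      ring
    _ ≤ g.factorial * ((6 * d ^ (g + 1)) * 6 ^ g) := by
      gcongr
      norm_num
    _ = g.factorial * (6 * d) ^ (g + 1) := by
      rw [mul_pow]
      ring

end Estimates

/-! ### Choice of the parameters and the two bounds -/

section Bounds

variable {n d g M : ℕ} {x : ℝ}

theorem attention_lower_bound (hg : 1 ≤ g) (hn : (d + g).choose g ≤ n) (hx : 1000 ≤ x)
    (hxM : x ^ (g + 1) = M) (hM : 1728 * (M : ℝ) ≤ d * ((d + g).choose g : ℝ)) {k : ℕ}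
    (hk : k ∈ (attentionDAG n d g).ioCosts M) :
    (n : ℝ) * (d + g).choose g * d * g ≤ 1728 * (k * x ^ g) := by
  have hg' : (1 : ℝ) ≤ g := by exact_mod_cast hg
  have hg2 := natCast_le_two_pow g
  have hM1 : 1 ≤ M := by
    have : (1 : ℝ) ≤ M := hxM ▸ one_le_pow₀ (by linarith)
    exact_mod_cast this
  have hgx : 1000 ≤ g * x := by nlinarith
  -- This is, up to a constant factor, the largest `s` with `s * (s + g).choose g ≤ M`, since
  -- `(gx)^g / g!` is about `(e x)^g`.
  set s : ℕ := ⌊g * x / 12⌋₊ with hs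
  have hs_le : (s : ℝ) ≤ g * x / 12 := Nat.floor_le (by positivity)
  have hs_ge : g * x / 24 ≤ s := by
    have := Nat.lt_floor_add_one (g * x / 12)
    linarith
  have hs1 : 1 ≤ s := by
    have : (1 : ℝ) ≤ s := by linarith
    exact_mod_cast this
  have hs2 : s ^ 2 ≤ M := by
    have h1 : (g : ℝ) ≤ x ^ g := by
      calc (g : ℝ) ≤ 2 ^ g := by linarith
        _ ≤ x ^ g := by gcongr; linarith
    have h2 : (s : ℝ) ^ 2 ≤ M := by
      have h3 : (g : ℝ) ^ 2 ≤ 144 * x ^ (g - 1) := by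
        calc (g : ℝ) ^ 2 ≤ (2 ^ g) ^ 2 := by gcongr; linarith
          _ = 4 ^ g := by rw [← pow_mul, mul_comm, pow_mul]; norm_num
          _ = 4 * 4 ^ (g - 1) := by rw [← pow_succ', Nat.sub_add_cancel hg]
          _ ≤ 144 * x ^ (g - 1) := by gcongr <;> linarith
      calc (s : ℝ) ^ 2 ≤ (g * x / 12) ^ 2 := by gcongr
        _ = (g : ℝ) ^ 2 * (x ^ 2 / 144) := by ring
        _ ≤ (144 * x ^ (g - 1)) * (x ^ 2 / 144) := by gcongr
        _ = x ^ (g - 1 + 2) := by ring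
        _ = M := by rw [← hxM]; congr 1; omega
    exact_mod_cast h2
  have hs3 : s * (s + g).choose g ≤ M := by
    have h1 := factorial_mul_choose_le_pow (s + g) g
    have h2 := pow_self_le g
    have hf : (0 : ℝ) < g.factorial := by positivity
    -- Both `s` and `g` are at most `g x / 12`. The `6` beats the factor `2 · 2.72` that comes from
    -- `g ≤ 2^g` and from `g^g / g!`.
    have h3 : ((s + g : ℕ) : ℝ) ≤ g * x / 6 := by
      push_cast
      nlinarith
    have h4 : (s : ℝ) * (s + g).choose g ≤ M := by
      refine le_of_mul_le_mul_left ?_ hf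
      calc (g.factorial : ℝ) * (s * (s + g).choose g)
          = s * (g.factorial * ((s + g).choose g : ℝ)) := by ring
        _ ≤ (g * x / 12) * (g * x / 6) ^ g := by
          gcongr
          exact h1.trans (by gcongr)
        _ = x ^ (g + 1) * ((g / 12) * ((g : ℝ) ^ g / 6 ^ g)) := by
          rw [div_pow, mul_pow]
          ring
        _ ≤ x ^ (g + 1) * ((2 ^ g / 12) * (g.factorial * (2.72 : ℝ) ^ g / 6 ^ g)) := by
          gcongr
          linarith
        _ = x ^ (g + 1) * (g.factorial * ((2 * 2.72 / 6) ^ g / 12)) := by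
          rw [div_pow, mul_pow]
          ring
        _ ≤ x ^ (g + 1) * (g.factorial * 1) := by
          gcongr
          have : ((2 : ℝ) * 2.72 / 6) ^ g ≤ 1 := pow_le_one₀ (by norm_num) (by norm_num)
          linarith
        _ = g.factorial * M := by rw [hxM]; ring
    exact_mod_cast h4
  have hcost : (s : ℝ) * (n * (d + g).choose g * d) ≤ 36 * M * (k + M) := by
    exact_mod_cast attention_cost_lower hn hM1 hs1 hs2 hs3 hk
  set r : ℝ := ((d + g).choose g : ℝ) with hr
  have hnr : r ≤ n := by rw [hr]; exact_mod_cast hn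
  have hr0 : 0 ≤ r := Nat.cast_nonneg _
  have hxg : x ^ g ≤ r * g := by
    refine pow_le_choose_mul hg (by linarith) ?_
    rw [hxM]
    have : (0 : ℝ) ≤ M := Nat.cast_nonneg _
    linarith
  have hx0 : 0 < x := by linarith
  have hMpos : (0 : ℝ) < M := by exact_mod_cast hM1
  -- This absorbs the additive `M` in `36 M (k + M)`, the loss of one phase; it is the place where
  -- `M` must be small compared to `d r`, with `1728 = 72 · 24`.
  have hsmall : 72 * (M : ℝ) ^ 2 ≤ s * (n * r * d) := by
    calc 72 * (M : ℝ) ^ 2 = (1728 * M) * (x ^ g * x / 24) := by rw [← pow_succ, hxM]; ring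
      _ ≤ (d * r) * ((r * g) * x / 24) := by gcongr
      _ = (g * x / 24) * (r * r * d) := by ring
      _ ≤ s * (n * r * d) := by gcongr
  have hmain : (s : ℝ) * (n * r * d) ≤ 72 * (M * k) := by nlinarith
  have hfin : (n * r * d * g) * x ≤ (1728 * (k * x ^ g)) * x := by
    calc (n * r * d * g) * x = 24 * ((g * x / 24) * (n * r * d)) := by ring
      _ ≤ 24 * (s * (n * r * d)) := by gcongr
      _ ≤ 24 * (72 * (M * k)) := by gcongr
      _ = (1728 * (k * x ^ g)) * x := by rw [← hxM]; ring
  exact le_of_mul_le_mul_right hfin hx0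

theorem attention_upper_bound (hg : 1 ≤ g) (hn : (d + g).choose g ≤ n) (hx : 1000 ≤ x)
    (hxM : x ^ (g + 1) = M) (hM : (M : ℝ) ≤ d * ((d + g).choose g : ℝ)) :
    ∃ k ∈ (attentionDAG n d g).ioCosts M,
      k * x ^ g ≤ 38 * (n * (d + g).choose g * d * (4 * Real.exp 1 ^ 2) ^ g) := by
  have hx0 : 0 < x := by linarith
  have hg' : (1 : ℝ) ≤ g := by exact_mod_cast hg
  have hg2 := natCast_le_two_pow g
  rw [← hxM] at hM
  have hn1 : 1 ≤ n := le_trans (Nat.choose_pos (by omega)) hn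
  have hd2 : 2 * g ≤ d := two_mul_le_of_large hx hM
  have hd : 0 < (d : ℝ) := by
    have : 0 < d := by omega
    exact_mod_cast this
  have hxd1 := mul_succ_le_of_large hx hM
  have hxd2 := mul_le_of_large hx hM
  have hxg := pow_le_choose_mul hg hx0.le hM
  -- The block size must make `((gb+g).choose g) * b`, roughly `(e b)^g b`, fit into `M = x^g x`;
  -- `6` leaves room for the inputs of a row and for rounding.
  set b : ℕ := ⌊x / 6⌋₊ with hb
  have hb_le : (b : ℝ) ≤ x / 6 := Nat.floor_le (by positivity)
  have hb_ge : 10 * x ≤ 61 * b := by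
    have := Nat.lt_floor_add_one (x / 6)
    linarith
  have hb0 : (0 : ℝ) < b := by linarith
  have hb1 : 1 ≤ b := by exact_mod_cast hb0
  have hgb : g * b ≤ d := by
    have : (g : ℝ) * b ≤ d := by nlinarith
    exact_mod_cast this
  have hbd : b ≤ d := le_trans (Nat.le_mul_of_pos_left b hg) hgb
  have hmem : (g * b + g).choose g * b + g * b + b + 3 ≤ M := by
    have hF : ((g * b + g).choose g : ℝ) ≤ x ^ g / 2 := by
      have h1 := factorial_mul_choose_le_pow (g * b + g) g
      have h2 := pow_self_le g
      have hf : (0 : ℝ) < g.factorial := by positivity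
      refine le_of_mul_le_mul_left ?_ hf
      calc (g.factorial : ℝ) * (g * b + g).choose g ≤ ((g * b + g : ℕ) : ℝ) ^ g := h1
        _ = (g : ℝ) ^ g * (b + 1) ^ g := by rw [← mul_pow]; push_cast; ring
        _ ≤ (g.factorial * (2.72 : ℝ) ^ g) * (x * (10 / 59)) ^ g := by
          gcongr
          linarith
        _ = g.factorial * (x ^ g * (2.72 * (10 / 59)) ^ g) := by
          rw [mul_pow, mul_pow]; ring
        _ ≤ g.factorial * (x ^ g * (1 / 2)) := by
          gcongr
          calc ((2.72 : ℝ) * (10 / 59)) ^ g ≤ (1 / 2) ^ g :=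
                pow_le_pow_left₀ (by norm_num) (by norm_num) g
            _ ≤ (1 / 2) ^ 1 := pow_le_pow_of_le_one (by norm_num) (by norm_num) hg
            _ = 1 / 2 := pow_one _
        _ = g.factorial * (x ^ g / 2) := by ring
    have hgx : (g : ℝ) + 1 ≤ x ^ g := hg2.trans (by gcongr; linarith)
    have hx1 : 1000 ≤ x ^ (g + 1) := hx.trans (le_self_pow₀ (by linarith) (by omega))
    have h : ((g * b + g).choose g : ℝ) * b + g * b + b + 3 ≤ M := by
      calc ((g * b + g).choose g : ℝ) * b + g * b + b + 3
          = ((g * b + g).choose g : ℝ) * b + (g + 1) * b + 3 := by ring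
        _ ≤ (x ^ g / 2) * (x / 6) + x ^ g * (x / 6) + 3 := by gcongr
        _ = x ^ (g + 1) * (1 / 4) + 3 := by ring
        _ ≤ M := by rw [← hxM]; linarith
    exact_mod_cast h
  obtain ⟨k, hk, hkle⟩ := attention_cost_blocks hn1 hb1 hmem
  refine ⟨k, hk, ?_⟩
  set r : ℝ := ((d + g).choose g : ℝ) with hr
  have hr0 : 0 ≤ r := Nat.cast_nonneg _
  set c : ℕ := (d / b + 1 + g).choose g with hc
  have hk1 : k ≤ 32 * (c * n * d * g) + 6 * (n * d) := by
    -- As `g b ≤ d`, a class has at most about `r ≤ n` monomials, so moving the entries of `H` costs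
    -- no more than streaming the rows.
    have hF : (g * b + g).choose g ≤ n := (Nat.choose_le_choose g (by omega)).trans hn
    have hq : (d / b + 1) * b ≤ 2 * d := by
      have := Nat.div_mul_le_self d b
      rw [add_mul]
      omega
    have hwork : (g * b + g).choose g * b + n * (g * b + b + 1) ≤ 4 * (n * (g * b)) := by
      have h1 : (g * b + g).choose g * b ≤ n * b := Nat.mul_le_mul_right b hF
      have h2 : b ≤ g * b := Nat.le_mul_of_pos_left b hg
      have h3 : n * (b + g * b + b + 1) ≤ n * (4 * (g * b)) := Nat.mul_le_mul_left n (by omega)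
      calc _ ≤ n * b + n * (g * b + b + 1) := Nat.add_le_add_right h1 _
        _ = n * (b + g * b + b + 1) := by ring
        _ ≤ n * (4 * (g * b)) := h3
        _ = 4 * (n * (g * b)) := by ring
    refine hkle.trans (Nat.add_le_add_right ?_ _)
    calc 4 * (c * (d / b + 1) * ((g * b + g).choose g * b + n * (g * b + b + 1)))
        ≤ 4 * (c * (d / b + 1) * (4 * (n * (g * b)))) := by gcongr
      _ = 16 * (c * n * g) * ((d / b + 1) * b) := by ring
      _ ≤ 16 * (c * n * g) * (2 * d) := by gcongr
      _ = 32 * (c * n * d * g) := by ring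
  have hk2 : (k : ℝ) ≤ 32 * (c * n * d * g) + 6 * (n * d) := by exact_mod_cast hk1
  -- The constant is `14.26 = 6.1 + 8.16`: the first part bounds `(d / b) x / d`, the second `(g +
  -- 1) x / d`.
  have hcx : (c : ℝ) * x ^ g ≤ r * 14.26 ^ g := by
    have hf : (0 : ℝ) < g.factorial := by positivity
    have h1 : (((d / b + 1 + g : ℕ) : ℝ)) * x ≤ 14.26 * d := by
      have h2 : ((d / b : ℕ) : ℝ) * b ≤ d := by exact_mod_cast Nat.div_mul_le_self d b
      have h3 : ((d / b : ℕ) : ℝ) * x ≤ 6.1 * d := by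
        have : x ≤ 6.1 * b := by linarith
        calc ((d / b : ℕ) : ℝ) * x ≤ ((d / b : ℕ) : ℝ) * (6.1 * b) := by gcongr
          _ = 6.1 * (((d / b : ℕ) : ℝ) * b) := by ring
          _ ≤ 6.1 * d := by gcongr
      push_cast at h3 ⊢
      linarith
    refine le_of_mul_le_mul_left ?_ hf
    calc (g.factorial : ℝ) * (c * x ^ g) = (g.factorial * c) * x ^ g := by ring
      _ ≤ ((d / b + 1 + g : ℕ) : ℝ) ^ g * x ^ g := by
        gcongr
        exact factorial_mul_choose_le_pow _ _
      _ = (((d / b + 1 + g : ℕ) : ℝ) * x) ^ g := (mul_pow _ _ _).symm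
      _ ≤ (14.26 * d) ^ g := by gcongr
      _ = 14.26 ^ g * (d : ℝ) ^ g := mul_pow _ _ _
      _ ≤ 14.26 ^ g * (g.factorial * r) := by
        gcongr
        exact pow_le_factorial_mul_choose d g
      _ = g.factorial * (r * 14.26 ^ g) := by ring
  -- `28.52 = 2 · 14.26`, with the `2` from `g ≤ 2^g`, is just below `4e²`.
  have he : (28.52 : ℝ) ^ g ≤ (4 * Real.exp 1 ^ 2) ^ g := by
    gcongr
    nlinarith [Real.exp_one_gt_d9]
  have h2e : (2 : ℝ) ^ g ≤ (4 * Real.exp 1 ^ 2) ^ g :=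
    le_trans (by gcongr; norm_num) he
  calc k * x ^ g ≤ (32 * (c * n * d * g) + 6 * (n * d)) * x ^ g := by gcongr
    _ = 32 * (n * d * g) * (c * x ^ g) + 6 * (n * d) * x ^ g := by ring
    _ ≤ 32 * (n * d * 2 ^ g) * (r * 14.26 ^ g) + 6 * (n * d) * (r * 2 ^ g) := by
      have : (g : ℝ) ≤ 2 ^ g := by linarith
      gcongr
      exact hxg.trans (by gcongr)
    _ = 32 * (n * r * d * 28.52 ^ g) + 6 * (n * r * d * 2 ^ g) := by
      rw [show (28.52 : ℝ) = 2 * 14.26 by norm_num, mul_pow]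
      ring
    _ ≤ 32 * (n * r * d * (4 * Real.exp 1 ^ 2) ^ g) +
        6 * (n * r * d * (4 * Real.exp 1 ^ 2) ^ g) := by gcongr
    _ = 38 * (n * r * d * (4 * Real.exp 1 ^ 2) ^ g) := by ring

end Bounds

theorem theorem2 :
    ∃ C c : ℝ, 0 < C ∧ 0 < c ∧
      ∀ (ι : Type) (l : Filter ι) (n d g M r : ι → ℕ),
        (∀ x, r x = (d x + g x).choose (g x)) →
        (∀ᶠ x in l, 1 ≤ g x) →
        (∀ᶠ x in l, r x ≤ n x) →
        (fun x => (M x : ℝ)) =o[l] (fun x => (d x : ℝ) * (r x : ℝ)) →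
        (fun x => (g x : ℝ)) =o[l] (fun x => Real.log (M x : ℝ)) →
        ∀ᶠ x in l, ∃ opt : ℕ,
          IsLeast ((attentionDAG (n x) (d x) (g x)).ioCosts (M x)) opt ∧
          (opt : ℝ) ≤ C * ((n x : ℝ) * (r x : ℝ) * (d x : ℝ) * (4 * Real.exp 1 ^ 2) ^ g x /
            (M x : ℝ) ^ ((g x : ℝ) / ((g x : ℝ) + 1))) ∧
          c * ((n x : ℝ) * (r x : ℝ) * (d x : ℝ) * (g x : ℝ) /
            (M x : ℝ) ^ ((g x : ℝ) / ((g x : ℝ) + 1))) ≤ (opt : ℝ) := by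
  refine ⟨38, 1 / 1728, by norm_num, by norm_num, ?_⟩
  intro ι l n d g M r hr hg hn hMo hgo
  -- From `2 g log 1000 ≤ log M` and `g + 1 ≤ 2g` it follows that `M ≥ 1000^(g+1)`, that is, `x ≥
  -- 1000`.
  have hlog : 0 < 2 * Real.log 1000 := mul_pos two_pos (Real.log_pos (by norm_num))
  filter_upwards [hg, hn, hMo.bound (show (0 : ℝ) < 1 / 1728 by norm_num),
    hgo.bound (inv_pos.2 hlog)] with e hg hn hM hgl
  rw [hr e] at hn hM ⊢
  generalize n e = n at hn ⊢
  generalize d e = d at hn hM ⊢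
  generalize g e = g at hg hn hM hgl ⊢
  generalize M e = M at hM hgl ⊢
  rw [Real.norm_of_nonneg (by positivity), Real.norm_of_nonneg (by positivity)] at hM
  have hg' : (1 : ℝ) ≤ g := by exact_mod_cast hg
  rw [Real.norm_of_nonneg (by positivity), Real.norm_of_nonneg (Real.log_natCast_nonneg M),
    inv_mul_eq_div, le_div_iff₀ hlog] at hgl
  have hMpos : (0 : ℝ) < M := by
    -- For `M = 0` the logarithm takes the default value `0`, which contradicts `g ≥ 1`.
    rcases Nat.eq_zero_or_pos M with rfl | h
    · rw [Nat.cast_zero, Real.log_zero] at hgl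
      nlinarith
    · exact_mod_cast h
  have hMge : (1000 : ℝ) ^ (g + 1) ≤ M := by
    rw [← Real.log_le_log_iff (by positivity) hMpos, Real.log_pow]
    refine le_trans ?_ hgl
    push_cast
    nlinarith
  set x : ℝ := (M : ℝ) ^ (((g + 1 : ℕ) : ℝ)⁻¹) with hx
  have hxM : x ^ (g + 1) = M := Real.rpow_inv_natCast_pow hMpos.le (by omega)
  have hx0 : 0 < x := Real.rpow_pos_of_pos hMpos _
  have hx1000 : 1000 ≤ x := by
    rw [← hxM] at hMge
    exact le_of_pow_le_pow_left₀ (by omega) hx0.le hMge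
  have hpow : (M : ℝ) ^ ((g : ℝ) / ((g : ℝ) + 1)) = x ^ g := by
    rw [hx, ← Real.rpow_natCast, ← Real.rpow_mul hMpos.le]
    congr 1
    push_cast
    rw [div_eq_inv_mul]
  obtain ⟨k, hk, hkle⟩ := attention_upper_bound hg hn hx1000 hxM (by linarith)
  have hleast := Nat.sInf_mem (⟨k, hk⟩ : ((attentionDAG n d g).ioCosts M).Nonempty)
  refine ⟨_, ⟨hleast, fun k' hk' => Nat.sInf_le hk'⟩, ?_, ?_⟩
  · rw [hpow, mul_div_assoc', le_div_iff₀ (by positivity)]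
    refine le_trans ?_ hkle
    gcongr
    exact Nat.sInf_le hk
  · rw [hpow, mul_div_assoc', div_le_iff₀ (by positivity)]
    have := attention_lower_bound hg hn hx1000 hxM (by linarith) hleast
    linarith
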